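/- **Conventions.** For a finite alphabet $A$, the positions of a word $u\in A^*$ are $1,\dots,|u|$. *Logic.* $\mathrm{FO}^2$ is the set of first-order formulas over words with two variable symbols, the letter predicates $\mathbf a$ ($a\in A$), $<$ and $=$, with negation on atomic formulas only. A block in the sequence of quantifiers ($\exists$ or $\forall$) along a path of the parsing tree is a maximal factor consisting of equal quantifiers. $\mathrm{FO}^2_m$ is the set of $\mathrm{FO}^2$-formulas with at most $m$ blocks on each path from the root to a leaf, and $\mathcal{FO}^2_m$ is the class of languages definable by sentences in $\mathrm{FO}^2_m$. The same notation in boldface, $\mathbf{FO}^2_m$, denotes the corresponding pseudovariety of monoids: the one generated by the syntactic monoids of the languages in $\mathcal{FO}^2_m$. *Temporal logic.* Formulas of $\mathrm{TL}$ are built from $\top$ by Boolean connectives and the operators $\mathsf X_a,\mathsf Y_a$ ($a\in A$): $(u,i)\models\mathsf X_a\varphi$ (resp. $\mathsf Y_a\varphi$) if there is an $a$-position $j>i$ (resp. $j<i$) and the least (resp. greatest) such $j$ satisfies $(u,j)\models\varphi$. A word satisfies a formula if the formula holds when its outermost $\mathsf X$-operators are evaluated at $0$ and its outermost $\mathsf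 Y$-operators at $|u|+1$. $\underline{\mathcal{TL}}_m$ is the class of languages definable by formulas in which the operators along each branch form at most $m$ blocks (maximal factors of $\mathsf X$-operators or of $\mathsf Y$-operators). *Rankers.* A ranker is a non-empty word $r=\mathsf Z_1\cdots\mathsf Z_n$ over $\{\mathsf X_a,\mathsf Y_a\mid a\in A\}$; its depth is $n$, and its blocks are its maximal factors consisting of $\mathsf X$-letters only or of $\mathsf Y$-letters only. Let $\mathsf X_a(u,i)$ (resp. $\mathsf Y_a(u,i)$) be the least (resp. greatest) $a$-position of $u$ that is $>i$ (resp. $<i$). Put $(i_0,j_0)=(0,|u|+1)$ and, for $1\le\ell\le n$, let $p_\ell=\mathsf X_a(u,i_{\ell-1})$ if $\mathsf Z_\ell=\mathsf X_a$ and $p_\ell=\mathsf Y_a(u,j_{\ell-1})$ if $\mathsf Z_\ell=\mathsf Y_a$; for $\ell<n$ let $(i_\ell,j_\ell)=(p_\ell,j_{\ell-1})$ if $\mathsf Z_{\ell+1}$ is an $\mathsf X$-letter and $(i_\ell,j_\ell)=(i_{\ell-1},p_\ell)$ if it is a $\mathsf Y$-letter. The ranker $r$ is *condensed on $u$* if every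 $p_\ell$ is defined and $i_{\ell-1}<p_\ell<j_{\ell-1}$ for all $\ell$. For $n\ge m\ge1$ write $u\triangleright_{m,n}v$ (resp. $u\triangleleft_{m,n}v$) if the same rankers are condensed on $u$ and $v$ among those that start with an $\mathsf X$-letter (resp. a $\mathsf Y$-letter) and have exactly $m$ blocks and depth at most $n$, and those (with any first letter) that have fewer than $m$ blocks and depth less than $n$. These relations are congruences of finite index. $\mathbf R_m$ (resp. $\mathbf L_m$) is the pseudovariety of monoids generated by the quotients $A^*/{\triangleright_{m,n}}$ (resp. $A^*/{\triangleleft_{m,n}}$), for all finite alphabets $A$ and all $n\ge m$. $\mathbf V\vee\mathbf W$ is the least pseudovariety containing $\mathbf V$ and $\mathbf W$. A monoid $M$ recognizes $K\subseteq A^*$ if $K=h^{-1}(h(K))$ for some morphism $h\colon A^*\to M$. **Example.** Let $L=\{b,c\}^*ca\{a,b\}^*$ over the alphabet $\{a,b,c\}$. 1. $L$ is $\mathrm{FO}^2_2$-definable. It is defined by the following sentence of $\mathrm{FO}^2_2$ (where an implication $\varphi\to\psi$ stands for $\neg\varphi\vee\psi$): $$\begin{aligned}&\exists i\,\bigl(\mathbf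 c(i)\wedge\forall j\,(j<i\to\neg\mathbf a(j))\wedge\forall j\,(j>i\to\neg\mathbf c(j))\bigr)\\ \wedge\ &\exists i\,\bigl(\mathbf a(i)\wedge\forall j\,(j<i\to\neg\mathbf a(j))\wedge\forall j\,(j>i\to\neg\mathbf c(j))\bigr)\\ \wedge\ &\forall i\,\bigl(\mathbf b(i)\to(\exists j\,(j<i\wedge\mathbf a(j))\vee\exists j\,(j>i\wedge\mathbf c(j)))\bigr).\end{aligned}$$ 2. No monoid in $\mathbf R_2\vee\mathbf L_2$ recognizes $L$. 3. $\mathbf R_2\vee\mathbf L_2\subsetneq\mathbf{FO}^2_2$ and $\mathbf R_2\vee\mathbf L_2\subsetneq\mathbf R_3\cap\mathbf L_3$. 4. $\underline{\mathcal{TL}}_2$ is properly contained in $\mathcal{FO}^2_2$: over every finite alphabet each $\underline{\mathcal{TL}}_2$-language is in $\mathcal{FO}^2_2$, and over some finite alphabet some $\mathcal{FO}^2_2$-language is not in $\underline{\mathcal{TL}}_2$. -/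

import Mathlib

open scoped Computability

namespace FO2Words

/-! ### Words, letters, blocks -/

/-- `LetterAt u p a`: the position `p` of `u` carries the letter `a`; the positions of `u` are
`1, …, |u|`. -/
def LetterAt {A : Type} (u : List A) (p : ℕ) (a : A) : Prop :=
  1 ≤ p ∧ u[p - 1]? = some a

/-- The number of blocks (maximal constant factors) of a word. -/
def blockCount {α : Type} [DecidableEq α] (w : List α) : ℕ :=
  (w.destutter (· ≠ ·)).length

/-- A class of languages: a set of languages over `A`, for each finite alphabet `A`. -/
abbrev LanguageClass : Type 1 := (A : Type) → [Finite A] → Set (Language A)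

/-- Proper containment of classes of languages. -/
def ProperlyContained (V W : LanguageClass) : Prop :=
  (∀ (A : Type) [Finite A], V A ⊆ W A) ∧ ∃ (A : Type) (_ : Finite A), ∃ K ∈ W A, K ∉ V A

/-! ### Two-variable first-order logic -/

/-- The two quantifiers. -/
inductive Quant
  | ex
  | all
  deriving DecidableEq

/-- First-order formulas over words with the two variable symbols `0, 1 : Fin 2` (which may be
requantified), with negation on atomic formulas only. -/
inductive Formula (A : Type) : Type
  | letter (a : A) (x : Fin 2)
  | notLetter (a : A) (x : Fin 2)
  | lt (x y : Fin 2)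
  | notLt (x y : Fin 2)
  | eq (x y : Fin 2)
  | notEq (x y : Fin 2)
  | and (φ ψ : Formula A)
  | or (φ ψ : Formula A)
  | ex (x : Fin 2) (φ : Formula A)
  | all (x : Fin 2) (φ : Formula A)

/-- Satisfaction in the word `u` under the assignment `v`; the quantifiers range over the
positions of `u`. -/
def Formula.Sat {A : Type} (u : List A) : Formula A → (Fin 2 → ℕ) → Prop
  | .letter a x, v => LetterAt u (v x) a
  | .notLetter a x, v => ¬ LetterAt u (v x) a
  | .lt x y, v => v x < v y
  | .notLt x y, v => ¬ v x < v y
  | .eq x y, v => v x = v y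
  | .notEq x y, v => v x ≠ v y
  | .and φ ψ, v => φ.Sat u v ∧ ψ.Sat u v
  | .or φ ψ, v => φ.Sat u v ∨ ψ.Sat u v
  | .ex x φ, v => ∃ p, 1 ≤ p ∧ p ≤ u.length ∧ φ.Sat u (Function.update v x p)
  | .all x φ, v => ∀ p, 1 ≤ p → p ≤ u.length → φ.Sat u (Function.update v x p)

/-- The free variables of a formula. -/
def Formula.freeVars {A : Type} : Formula A → Finset (Fin 2)
  | .letter _ x => {x}
  | .notLetter _ x => {x}
  | .lt x y => {x, y}
  | .notLt x y => {x, y}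
  | .eq x y => {x, y}
  | .notEq x y => {x, y}
  | .and φ ψ => φ.freeVars ∪ ψ.freeVars
  | .or φ ψ => φ.freeVars ∪ ψ.freeVars
  | .ex x φ => φ.freeVars.erase x
  | .all x φ => φ.freeVars.erase x

/-- The quantifier labels of the paths from the root to a leaf in the parsing tree. -/
def Formula.pathLabels {A : Type} : Formula A → List (List Quant)
  | .letter _ _ => [[]]
  | .notLetter _ _ => [[]]
  | .lt _ _ => [[]]
  | .notLt _ _ => [[]]
  | .eq _ _ => [[]]
  | .notEq _ _ => [[]]
  | .and φ ψ => φ.pathLabels ++ ψ.pathLabels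
  | .or φ ψ => φ.pathLabels ++ ψ.pathLabels
  | .ex _ φ => φ.pathLabels.map (Quant.ex :: ·)
  | .all _ φ => φ.pathLabels.map (Quant.all :: ·)

/-- `FO²_{m,n}`: quantifier depth at most `n`, and at most `m` blocks on every path. -/
def FOfragDepth (A : Type) (m n : ℕ) : Set (Formula A) :=
  {φ | ∀ w ∈ φ.pathLabels, w.length ≤ n ∧ blockCount w ≤ m}

/-- `FO²_m`, the union of the `FO²_{m,n}` over all `n`. -/
def FOfrag (A : Type) (m : ℕ) : Set (Formula A) :=
  ⋃ n, FOfragDepth A m n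

/-- The sentence `φ` defines the language `K`. The assignment plays no role, since `φ` has no
free variable. -/
def Formula.Defines {A : Type} (φ : Formula A) (K : Language A) : Prop :=
  φ.freeVars = ∅ ∧ ∀ u : List A, u ∈ K ↔ φ.Sat u (fun _ => 0)

/-- The class of `FO²_m`-definable languages. -/
def FOLang (m : ℕ) : LanguageClass :=
  fun A _ => {K | ∃ φ ∈ FOfrag A m, φ.Defines K}

/-! ### Rankers -/

/-- The directions: `X` is to the right (future), `Y` is to the left (past). -/
inductive Dir
  | X
  | Y
  deriving DecidableEq

/-- `IsNext u X a p q`: `q` is the least `a`-position of `u` with `p < q`;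
`IsNext u Y a p q`: `q` is the greatest `a`-position of `u` with `q < p`. -/
def IsNext {A : Type} (u : List A) : Dir → A → ℕ → ℕ → Prop
  | .X, a, p, q => LetterAt u q a ∧ p < q ∧ ∀ s, p < s → s < q → ¬ LetterAt u s a
  | .Y, a, p, q => LetterAt u q a ∧ q < p ∧ ∀ s, q < s → s < p → ¬ LetterAt u s a

/-- Rankers (the non-empty words of this type): the letter `X_a` is `(X, a)` and `Y_a` is
`(Y, a)`; the instructions are executed from left to right. -/
abbrev Ranker (A : Type) : Type := List (Dir × A)

/-- The `m`-block rankers of depth `n` that start with direction `d`. -/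
def rankers (A : Type) (d : Dir) (m n : ℕ) : Set (Ranker A) :=
  {r | (r.map Prod.fst).head? = some d ∧ blockCount (r.map Prod.fst) = m ∧ r.length = n}

/-- The underlined set of rankers: those with `m` blocks and depth at most `n` that start with
direction `d`, and all those with fewer than `m` blocks and depth less than `n`. -/
def rankersLE (A : Type) (d : Dir) (m n : ℕ) : Set (Ranker A) :=
  {r | (∃ n' ≤ n, r ∈ rankers A d m n') ∨
    ∃ m' < m, ∃ n' < n, ∃ d', r ∈ rankers A d' m' n'}

/-- `CondensedIn u r i j`: the ranker `r`, started at the left end `i` of the open interval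
`(i, j)` if it begins with an `X`-letter and at the right end `j` if it begins with a `Y`-letter,
is defined, and its successive positions zoom in: each of them lies in the current open interval,
and the interval then shrinks to the part of it on the side of the next move. Thus the intervals
form a strictly decreasing chain, and the last position lies in the last one. -/
def CondensedIn {A : Type} (u : List A) : Ranker A → ℕ → ℕ → Prop
  | [], _, _ => True
  | [(.X, a)], i, j => ∃ p, IsNext u .X a i p ∧ p < j
  | [(.Y, a)], i, j => ∃ p, IsNext u .Y a j p ∧ i < p
  | (.X, a) :: (.X, b) :: r, i, j =>
      ∃ p, IsNext u .X a i p ∧ p < j ∧ CondensedIn u ((.X, b) :: r) p j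
  | (.Y, a) :: (.Y, b) :: r, i, j =>
      ∃ p, IsNext u .Y a j p ∧ i < p ∧ CondensedIn u ((.Y, b) :: r) i p
  | (.X, a) :: (.Y, b) :: r, i, j =>
      ∃ p, IsNext u .X a i p ∧ p < j ∧ CondensedIn u ((.Y, b) :: r) i p
  | (.Y, a) :: (.X, b) :: r, i, j =>
      ∃ p, IsNext u .Y a j p ∧ i < p ∧ CondensedIn u ((.X, b) :: r) p j

/-- The ranker `r` is condensed on `u`. -/
def Condensed {A : Type} (u : List A) (r : Ranker A) : Prop :=
  CondensedIn u r 0 (u.length + 1)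

/-- `u` and `v` agree on condensed rankers from the underlined set with parameters `d, m, n`. -/
def CondAgree {A : Type} (d : Dir) (m n : ℕ) (u v : FreeMonoid A) : Prop :=
  ∀ r ∈ rankersLE A d m n, Condensed u.toList r ↔ Condensed v.toList r

/-! ### Temporal logic -/

/-- Formulas of unary temporal logic; `next X a` is `X_a` and `next Y a` is `Y_a`. -/
inductive TLFormula (A : Type) : Type
  | top
  | not (φ : TLFormula A)
  | and (φ ψ : TLFormula A)
  | or (φ ψ : TLFormula A)
  | next (d : Dir) (a : A) (φ : TLFormula A)

/-- `(u, i) ⊨ φ`. -/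
def TLFormula.SatAt {A : Type} (u : List A) : TLFormula A → ℕ → Prop
  | .top, _ => True
  | .not φ, i => ¬ φ.SatAt u i
  | .and φ ψ, i => φ.SatAt u i ∧ ψ.SatAt u i
  | .or φ ψ, i => φ.SatAt u i ∨ ψ.SatAt u i
  | .next d a φ, i => ∃ j, IsNext u d a i j ∧ φ.SatAt u j

/-- `u ⊨ φ`: outermost future operators are evaluated at `0`, outermost past operators at
`|u| + 1`. -/
def TLFormula.Sat {A : Type} (u : List A) : TLFormula A → Prop
  | .top => True
  | .not φ => ¬ φ.Sat u
  | .and φ ψ => φ.Sat u ∧ ψ.Sat u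
  | .or φ ψ => φ.Sat u ∨ ψ.Sat u
  | .next .X a φ => (TLFormula.next .X a φ).SatAt u 0
  | .next .Y a φ => (TLFormula.next .Y a φ).SatAt u (u.length + 1)

/-- The sequences of directions of the modal operators along the branches of the parsing tree. -/
def TLFormula.pathLabels {A : Type} : TLFormula A → List (List Dir)
  | .top => [[]]
  | .not φ => φ.pathLabels
  | .and φ ψ => φ.pathLabels ++ ψ.pathLabels
  | .or φ ψ => φ.pathLabels ++ ψ.pathLabels
  | .next d _ φ => φ.pathLabels.map (d :: ·)

/-- The underlined fragment `TL_m`: every branch has at most `m` blocks of operators of the same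
direction. -/
def TLfrag (A : Type) (m : ℕ) : Set (TLFormula A) :=
  {φ | ∀ w ∈ φ.pathLabels, blockCount w ≤ m}

/-- The class of languages definable in the underlined fragment `TL_m`. -/
def TLLang (m : ℕ) : LanguageClass :=
  fun A _ => {K | ∃ φ ∈ TLfrag A m, ∀ u : List A, u ∈ K ↔ φ.Sat u}

/-! ### Pseudovarieties of monoids -/

/-- A pseudovariety: a class of finite monoids closed under (finite) direct products, homomorphic
images and submonoids. -/
structure IsPseudovariety (V : Set MonCat.{0}) : Prop where
  finite : ∀ M ∈ V, Finite M
  prod : ∀ (ι : Type) [Finite ι] (M : ι → MonCat.{0}), (∀ i, M i ∈ V) →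
    MonCat.of (∀ i, M i) ∈ V
  image : ∀ M ∈ V, ∀ (N : MonCat.{0}) (f : M →* N), Function.Surjective f → N ∈ V
  submonoid : ∀ M ∈ V, ∀ S : Submonoid M, MonCat.of S ∈ V

/-- The pseudovariety generated by a class of finite monoids. -/
def pvGenerated (W : Set MonCat.{0}) : Set MonCat.{0} :=
  ⋂₀ {V | IsPseudovariety V ∧ W ⊆ V}

/-- The join of two pseudovarieties. -/
def pvJoin (V W : Set MonCat.{0}) : Set MonCat.{0} :=
  pvGenerated (V ∪ W)

/-- The monoid `M` recognizes `K`: there is a morphism `h` from the free monoid to `M` such that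
`K = h⁻¹(h(K))`. -/
def Recognizes {A : Type} (M : MonCat.{0}) (K : Language A) : Prop :=
  ∃ h : FreeMonoid A →* M,
    (K : Set (List A)) =
      (fun u => h (FreeMonoid.ofList u)) ⁻¹' ((fun u => h (FreeMonoid.ofList u)) '' K)

/-- The syntactic congruence of a language. -/
def syntacticCon {A : Type} (K : Language A) : Con (FreeMonoid A) where
  r u v := ∀ x y : FreeMonoid A,
    (x * u * y).toList ∈ K ↔ (x * v * y).toList ∈ K
  iseqv := ⟨fun _ _ _ => Iff.rfl, fun h x y => (h x y).symm,
    fun h h' x y => (h x y).trans (h' x y)⟩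
  mul' := by
    intro u v u' v' h h' x y
    have h1 := h x (u' * y)
    have h2 := h' (x * v) y
    simp only [mul_assoc] at h1 h2 ⊢
    exact h1.trans h2

/-- The pseudovariety corresponding to a variety of languages: it is generated by the syntactic
monoids of its languages. -/
def pvOf (V : LanguageClass) : Set MonCat.{0} :=
  pvGenerated {M | ∃ (A : Type) (_ : Finite A), ∃ K ∈ V A, M = MonCat.of (syntacticCon K).Quotient}

/-- The pseudovariety corresponding to the `FO²_m`-definable languages. -/
def FOpv (m : ℕ) : Set MonCat.{0} := pvOf (FOLang m)

/-- The pseudovariety generated by the quotients of the free monoids `A*` by the relations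
`CondAgree d m n`, for all finite alphabets `A` and all `n ≥ m`. These relations are congruences,
so that `conGen` does not identify any further words. -/
def condPv (d : Dir) (m : ℕ) : Set MonCat.{0} :=
  pvGenerated {M | ∃ (A : Type) (_ : Finite A), ∃ n ≥ m,
    M = MonCat.of (conGen (CondAgree (A := A) d m n)).Quotient}

/-- The pseudovariety `R_m`, given by rankers that start with an `X`-block. -/
def Rpv (m : ℕ) : Set MonCat.{0} := condPv .X m

/-- The pseudovariety `L_m`, given by rankers that start with a `Y`-block. -/
def Lpv (m : ℕ) : Set MonCat.{0} := condPv .Y m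

/-! ### The example -/

/-- The alphabet `{a, b, c}`. -/
inductive ABC
  | a
  | b
  | c
  deriving DecidableEq

instance : Fintype ABC := ⟨{.a, .b, .c}, by rintro (_ | _ | _) <;> decide⟩

/-- The language `{b,c}* c a {a,b}*`. -/
def exLang : Language ABC :=
  ({[.b], [.c]} : Language ABC)∗ * ({[.c, .a]} : Language ABC) * ({[.a], [.b]} : Language ABC)∗

/-- `∀ j (j < i → ¬ s(j))`, where `i` is the variable `0` and `j` is the variable `1`. -/
def noneBefore (s : ABC) : Formula ABC := .all 1 (.or (.notLt 1 0) (.notLetter s 1))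

/-- `∀ j (j > i → ¬ s(j))`, where `i` is the variable `0` and `j` is the variable `1`. -/
def noneAfter (s : ABC) : Formula ABC := .all 1 (.or (.notLt 0 1) (.notLetter s 1))

/-- The sentence
`∃ i (c(i) ∧ ∀ j (j < i → ¬ a(j)) ∧ ∀ j (j > i → ¬ c(j)))
  ∧ ∃ i (a(i) ∧ ∀ j (j < i → ¬ a(j)) ∧ ∀ j (j > i → ¬ c(j)))
  ∧ ∀ i (b(i) → (∃ j (j < i ∧ a(j)) ∨ ∃ j (j > i ∧ c(j))))`. -/
def exSentence : Formula ABC :=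
  .and (.ex 0 (.and (.letter .c 0) (.and (noneBefore .a) (noneAfter .c))))
    (.and (.ex 0 (.and (.letter .a 0) (.and (noneBefore .a) (noneAfter .c))))
      (.all 0 (.or (.notLetter .b 0)
        (.or (.ex 1 (.and (.lt 1 0) (.letter .a 1))) (.ex 1 (.and (.lt 0 1) (.letter .c 1)))))))

end FO2Words

/-! Rankers with at most two blocks are conditions on scattered subwords. For nonempty `α` and `β`,
consider the ranker with `X`-block `α` and `Y`-block `β`. The `X`-block traces the leftmost
embedding of `α` and ends at some `p`; the prefix of length `p - 1` is the longest one that does not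
contain `α`, and the `Y`-block embeds `β` backwards into it. So the ranker is defined on `u` iff `α`
embeds in `u` and some prefix contains `β.reverse` but not `α`. For condensedness the prefix must
contain `α.dropLast ++ β.reverse` instead (`rankerDefined_XY_iff`, `condensed_XY_iff`). Rankers
starting with `Y` follow by reversing words.

Upper bounds: `PrefixSep` is expressed by one `∃` followed by a chain of `∃` and a chain of `∀`,
hence in `FO²_2`. Both the classes of the congruences behind `R_2`, `L_2` and the `TL_2`-languages
depend only on finitely many such conditions (`condPv_two_subset`, `TLLang_subset_FOLang`).

Lower bounds: inserting `y` between `(yz)^N` and `(xy)^N` changes no short scattered subword and no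
short instance of `PrefixSep`, and the configuration is symmetric under reversal. So no two-block
ranker of depth at most `N` notices the insertion, and `R_2 ∨ L_2` satisfies the corresponding
identity (`pvJoin_subset_insertionPv`). But `(bc)^N (ab)^N` is in the example language while `(bc)^N
b (ab)^N` is not. This excludes recognition by `R_2 ∨ L_2` and also definability in `TL_2`.

The syntactic monoid of the language lies in both `R_3` and `L_3`: the action of a word on a
four-state automaton is determined by rankers of depth at most two and one further ranker, `X_a Y_c
X_b` or `Y_c X_a Y_b`, which finds a `b` between the last `c` and the first `a`
(`exRun_canonicalWord`). -/

namespace FO2Words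

/-! ### Positions and scattered subwords -/

section Subwords

variable {A : Type} {u : List A} {a : A} {α β γ : List A}

theorem letterAt_le_length {p : ℕ} (h : LetterAt u p a) : p ≤ u.length := by
  obtain ⟨h1, h2⟩ := h
  obtain ⟨h3, -⟩ := List.getElem?_eq_some_iff.1 h2
  omega

theorem concat_sublist_concat_iff {l : List A} {b : A} :
    (α ++ [a]).Sublist (l ++ [b]) ↔ (α ++ [a]).Sublist l ∨ (a = b ∧ α.Sublist l) := by
  rw [← List.reverse_sublist, ← List.reverse_sublist (l₂ := l), ← List.reverse_sublist (l₂ := l)]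
  simp only [List.reverse_append, List.reverse_cons, List.reverse_nil, List.nil_append,
    List.cons_append]
  rw [List.sublist_cons_iff]
  constructor
  · rintro (h | ⟨r, h, h'⟩)
    · exact Or.inl h
    · simp only [List.cons.injEq] at h
      exact Or.inr ⟨h.1, h.2 ▸ h'⟩
  · rintro (h | ⟨rfl, h⟩)
    · exact Or.inl h
    · exact Or.inr ⟨_, rfl, h⟩

/-- Peeling off the last letter is the recursion shared by `Y`-moves of rankers and by nested
quantifiers in formulas. -/
theorem concat_sublist_take_iff {q : ℕ} :
    (α ++ [a]).Sublist (u.take q) ↔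
      ∃ p ≤ q, LetterAt u p a ∧ α.Sublist (u.take (p - 1)) := by
  induction q with
  | zero =>
    simp only [List.take_zero, List.sublist_nil, List.append_eq_nil_iff, List.cons_ne_nil,
      and_false, false_iff]
    rintro ⟨p, hp, ⟨h, -⟩, -⟩
    omega
  | succ q ih =>
    rw [List.take_add_one]
    cases hq : u[q]? with
    | none =>
      rw [Option.toList_none, List.append_nil, ih]
      constructor
      · rintro ⟨p, hp, h⟩
        exact ⟨p, by omega, h⟩
      · rintro ⟨p, hp, h, h'⟩
        have := letterAt_le_length h
        rw [List.getElem?_eq_none_iff] at hq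
        exact ⟨p, by omega, h, h'⟩
    | some b =>
      rw [Option.toList_some, concat_sublist_concat_iff, ih]
      constructor
      · rintro (⟨p, hp, h⟩ | ⟨rfl, h⟩)
        · exact ⟨p, by omega, h⟩
        · exact ⟨q + 1, le_rfl, ⟨by omega, by simpa using hq⟩, by simpa using h⟩
      · rintro ⟨p, hp, h, h'⟩
        rcases Nat.lt_or_ge q p with hlt | hge
        · obtain rfl : p = q + 1 := by omega
          refine Or.inr ⟨?_, by simpa using h'⟩
          have := h.2
          simp only [Nat.add_sub_cancel, hq, Option.some.injEq] at this
          exact this.symm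
        · exact Or.inl ⟨p, hge, h, h'⟩

theorem sublist_take_mono {p q : ℕ} (hpq : p ≤ q) (h : α.Sublist (u.take p)) :
    α.Sublist (u.take q) :=
  h.trans (List.take_sublist_take_left hpq)

/-- `EndsAt u α p`: the leftmost embedding of `α` as a scattered subword of `u` ends at `p`. -/
def EndsAt (u α : List A) (p : ℕ) : Prop :=
  IsLeast {q | α.Sublist (u.take q)} p

theorem endsAt_nil : EndsAt u [] 0 :=
  ⟨List.nil_sublist _, fun _ _ => Nat.zero_le _⟩

theorem EndsAt.sublist_take_iff {p q : ℕ} (h : EndsAt u α p) : α.Sublist (u.take q) ↔ p ≤ q :=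
  ⟨fun hq => h.2 hq, fun hq => sublist_take_mono hq h.1⟩

theorem exists_endsAt_iff : (∃ p, EndsAt u α p) ↔ α.Sublist u := by
  constructor
  · rintro ⟨p, hp, -⟩
    exact hp.trans (List.take_sublist _ _)
  · intro h
    classical
    have h' : ∃ q, α.Sublist (u.take q) := ⟨u.length, by rwa [List.take_length]⟩
    exact ⟨Nat.find h', Nat.find_spec h', fun q hq => Nat.find_min' h' hq⟩

theorem EndsAt.le_length {p : ℕ} (h : EndsAt u α p) : p ≤ u.length :=
  h.2 (by simpa using h.1.trans (List.take_sublist _ _))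

/-- Greedy choice is optimal: the leftmost embedding is extended by the next occurrence of the new
letter. -/
theorem EndsAt.isNext_iff {i p : ℕ} (h : EndsAt u α i) :
    IsNext u .X a i p ↔ EndsAt u (α ++ [a]) p := by
  constructor
  · rintro ⟨h1, h2, h3⟩
    refine ⟨concat_sublist_take_iff.2 ⟨p, le_rfl, h1, h.sublist_take_iff.2 (by omega)⟩, ?_⟩
    intro q hq
    obtain ⟨s, hs, hs1, hs2⟩ := concat_sublist_take_iff.1 hq
    rw [h.sublist_take_iff] at hs2
    by_contra hlt
    have := hs1.1
    exact h3 s (by omega) (by omega) hs1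
  · intro hp
    obtain ⟨s, hs, hs1, hs2⟩ := concat_sublist_take_iff.1 hp.1
    have h1 : p ≤ s := hp.2 (concat_sublist_take_iff.2 ⟨s, le_rfl, hs1, hs2⟩)
    obtain rfl : p = s := by omega
    rw [h.sublist_take_iff] at hs2
    have := hs1.1
    refine ⟨hs1, by omega, fun t ht ht' hta => ?_⟩
    have : p ≤ t :=
      hp.2 (concat_sublist_take_iff.2 ⟨t, le_rfl, hta, h.sublist_take_iff.2 (by omega)⟩)
    omega

theorem EndsAt.unique {p q : ℕ} (h : EndsAt u α p) (h' : EndsAt u α q) : p = q :=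
  IsLeast.unique h h'

/-- The last `a`-position before `j` exists as soon as there is some `a`-position before `j`. -/
theorem exists_isNext_Y {p j : ℕ} (h : LetterAt u p a) (hp : p < j) :
    ∃ q, IsNext u .Y a j q ∧ p ≤ q := by
  classical
  let P : ℕ → Prop := fun q => LetterAt u q a
  have hle : p ≤ j - 1 := by omega
  refine ⟨Nat.findGreatest P (j - 1), ⟨Nat.findGreatest_spec (P := P) hle h, ?_, ?_⟩,
    Nat.le_findGreatest hle h⟩
  · have := Nat.findGreatest_le (P := P) (j - 1)
    omega
  · intro s hs hs' hsa
    have := Nat.le_findGreatest (P := P) (n := j - 1) (by omega) hsa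
    omega

theorem exists_isNext_X {p i : ℕ} (h : LetterAt u p a) (hp : i < p) :
    ∃ q, IsNext u .X a i q ∧ q ≤ p := by
  classical
  have h' : ∃ q, LetterAt u q a ∧ i < q := ⟨p, h, hp⟩
  exact ⟨Nat.find h', ⟨(Nat.find_spec h').1, (Nat.find_spec h').2, fun s hs hs' hsa =>
    Nat.find_min h' hs' ⟨hsa, hs⟩⟩, Nat.find_min' h' ⟨h, hp⟩⟩

/-! ### Rankers with at most two blocks as conditions on scattered subwords -/

/-- `Reach u r i p`: the ranker `r`, executed from the position `i` of `u`, is defined and ends at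
the position `p`. -/
def Reach (u : List A) : Ranker A → ℕ → ℕ → Prop
  | [], i, p => p = i
  | (d, a) :: r, i, p => ∃ k, IsNext u d a i k ∧ Reach u r k p

/-- The initial position of a ranker whose first letter has direction `d`. -/
def startPos (u : List A) : Dir → ℕ
  | .X => 0
  | .Y => u.length + 1

/-- The ranker `r` is defined on `u`. -/
def RankerDefined (u : List A) : Ranker A → Prop
  | [] => True
  | (d, a) :: r => ∃ p, Reach u ((d, a) :: r) (startPos u d) p

theorem reach_append {r s : Ranker A} {i p : ℕ} :
    Reach u (r ++ s) i p ↔ ∃ k, Reach u r i k ∧ Reach u s k p := by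
  induction r generalizing i with
  | nil => simp [Reach]
  | cons x r ih =>
    obtain ⟨d, a⟩ := x
    simp only [List.cons_append, Reach, ih]
    constructor
    · rintro ⟨k, hk, l, hl, h⟩
      exact ⟨l, ⟨k, hk, hl⟩, h⟩
    · rintro ⟨l, ⟨k, hk, hl⟩, h⟩
      exact ⟨k, hk, l, hl, h⟩

theorem EndsAt.reach_iff {i p : ℕ} (h : EndsAt u γ i) :
    Reach u (α.map (Prod.mk Dir.X)) i p ↔ EndsAt u (γ ++ α) p := by
  induction α generalizing γ i with
  | nil =>
    simp only [List.map_nil, Reach, List.append_nil]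
    exact ⟨fun hp => hp ▸ h, fun hp => hp.unique h⟩
  | cons a α ih =>
    simp only [List.map_cons, Reach]
    constructor
    · rintro ⟨k, hk, hp⟩
      rw [h.isNext_iff] at hk
      simpa using (ih hk).1 hp
    · intro hp
      obtain ⟨k, hk⟩ := exists_endsAt_iff.2
        (show (γ ++ [a]).Sublist u from
          ((by simp : (γ ++ [a]).Sublist (γ ++ a :: α))).trans
            (exists_endsAt_iff.1 ⟨p, hp⟩))
      exact ⟨k, h.isNext_iff.2 hk, (ih hk).2 (by simpa using hp)⟩

/-- Moving to the last occurrence leaves the longest prefix for the remaining letters, so the greedy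
search from the right succeeds whenever an embedding exists. -/
theorem reach_Y_iff {j : ℕ} :
    (∃ p, Reach u (β.map (Prod.mk Dir.Y)) j p) ↔ β.reverse.Sublist (u.take (j - 1)) := by
  induction β generalizing j with
  | nil => simp [Reach]
  | cons b β ih =>
    simp only [List.map_cons, Reach, List.reverse_cons, concat_sublist_take_iff]
    constructor
    · rintro ⟨p, k, hk, hp⟩
      have := hk.2.1
      exact ⟨k, by omega, hk.1, ih.1 ⟨p, hp⟩⟩
    · rintro ⟨k, hk, hkb, h⟩
      have := hkb.1
      obtain ⟨q, hq, hkq⟩ := exists_isNext_Y hkb (show k < j by omega)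
      obtain ⟨p, hp⟩ := ih.2 (sublist_take_mono (show k - 1 ≤ q - 1 by omega) h)
      exact ⟨p, q, hq, hp⟩

/-- Since `i` ends the leftmost embedding of `α`, staying to the right of `i` amounts to leaving
room for `α` in front of the letters read backwards. -/
theorem EndsAt.condensedIn_Y_iff {i j : ℕ} (h : EndsAt u α i) (hβ : β ≠ []) :
    CondensedIn u (β.map (Prod.mk Dir.Y)) i j ↔ (α ++ β.reverse).Sublist (u.take (j - 1)) := by
  induction β generalizing j with
  | nil => exact absurd rfl hβ
  | cons b β ih =>
    rw [List.reverse_cons, ← List.append_assoc, concat_sublist_take_iff]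
    cases β with
    | nil =>
      simp only [List.map_cons, List.map_nil, CondensedIn, List.reverse_nil, List.append_nil,
        h.sublist_take_iff]
      constructor
      · rintro ⟨p, hp, hip⟩
        have := hp.2.1
        exact ⟨p, by omega, hp.1, by omega⟩
      · rintro ⟨p, hpj, hp, hip⟩
        have := hp.1
        obtain ⟨q, hq, hpq⟩ := exists_isNext_Y hp (show p < j by omega)
        exact ⟨q, hq, by omega⟩
    | cons c β =>
      simp only [List.map_cons, CondensedIn] at ih ⊢
      constructor
      · rintro ⟨p, hp, hip, hc⟩
        have := hp.2.1
        exact ⟨p, by omega, hp.1, (ih (by simp)).1 hc⟩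
      · rintro ⟨p, hpj, hp, hs⟩
        have := hp.1
        obtain ⟨q, hq, hpq⟩ := exists_isNext_Y hp (show p < j by omega)
        have hs' := sublist_take_mono (show p - 1 ≤ q - 1 by omega) hs
        have hi := h.sublist_take_iff.1 ((List.sublist_append_left _ _).trans hs')
        have := hq.1.1
        exact ⟨q, hq, by omega, (ih (by simp)).2 hs'⟩

theorem EndsAt.condensedIn_X_iff {i j : ℕ} (h : EndsAt u γ i) (hj : u.length < j) (hα : α ≠ []) :
    CondensedIn u (α.map (Prod.mk Dir.X)) i j ↔ (γ ++ α).Sublist u := by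
  induction α generalizing γ i with
  | nil => exact absurd rfl hα
  | cons a α ih =>
    cases α with
    | nil =>
      simp only [List.map_cons, List.map_nil, CondensedIn, h.isNext_iff, ← exists_endsAt_iff]
      exact ⟨fun ⟨p, hp, _⟩ => ⟨p, hp⟩, fun ⟨p, hp⟩ => ⟨p, hp, hp.le_length.trans_lt hj⟩⟩
    | cons b α =>
      simp only [List.map_cons, CondensedIn, h.isNext_iff] at ih ⊢
      constructor
      · rintro ⟨p, hp, -, hc⟩
        simpa using (ih hp (by simp)).1 hc
      · intro hs
        obtain ⟨p, hp⟩ := exists_endsAt_iff.2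
          ((by simp : (γ ++ [a]).Sublist (γ ++ a :: b :: α)).trans hs)
        exact ⟨p, hp, hp.le_length.trans_lt hj, (ih hp (by simp)).2 (by simpa using hs)⟩

/-- A prefix of `u` contains the scattered subword `γ` but not the scattered subword `α`. -/
def PrefixSep (α γ u : List A) : Prop :=
  ∃ q, γ.Sublist (u.take q) ∧ ¬ α.Sublist (u.take q)

theorem endsAt_and_sublist_iff (hα : α ≠ []) :
    (∃ p, EndsAt u α p ∧ γ.Sublist (u.take (p - 1))) ↔ α.Sublist u ∧ PrefixSep α γ u := by
  constructor
  · rintro ⟨p, hp, hs⟩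
    refine ⟨exists_endsAt_iff.1 ⟨p, hp⟩, p - 1, hs, fun h => ?_⟩
    -- Here `p ≤ p - 1`, which truncated subtraction permits only for `p = 0`; then `α` would embed
    -- in the empty prefix.
    have := hp.2 h
    have hp0 : p = 0 := by omega
    have h1 := hp.1
    simp [hp0, hα] at h1
  · rintro ⟨hu, q, hq, hn⟩
    obtain ⟨p, hp⟩ := exists_endsAt_iff.2 hu
    rw [hp.sublist_take_iff] at hn
    exact ⟨p, hp, sublist_take_mono (by omega) hq⟩

/-- At the change of direction the last `X`-position becomes the right end of the interval, while
the left end stays at the previous `X`-position. This is the origin of `α.dropLast`. -/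
theorem EndsAt.condensedIn_XY_iff {i j : ℕ} (h : EndsAt u γ i) (hj : u.length < j) (hα : α ≠ [])
    (hβ : β ≠ []) :
    CondensedIn u (α.map (Prod.mk Dir.X) ++ β.map (Prod.mk Dir.Y)) i j ↔
      ∃ p, EndsAt u (γ ++ α) p ∧ (γ ++ α.dropLast ++ β.reverse).Sublist (u.take (p - 1)) := by
  induction α generalizing γ i with
  | nil => exact absurd rfl hα
  | cons a α ih =>
    cases α with
    | nil =>
      have hY := fun p => h.condensedIn_Y_iff (j := p) hβ
      cases β with
      | nil => exact absurd rfl hβ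
      | cons b β =>
        simp only [List.map_cons, List.map_nil, List.cons_append, List.nil_append, CondensedIn,
          h.isNext_iff, List.dropLast_singleton, List.append_nil] at hY ⊢
        simp only [hY]
        exact ⟨fun ⟨p, hp, _, h⟩ => ⟨p, hp, h⟩,
          fun ⟨p, hp, h⟩ => ⟨p, hp, hp.le_length.trans_lt hj, h⟩⟩
    | cons b α =>
      simp only [List.map_cons, List.cons_append, CondensedIn, h.isNext_iff] at ih ⊢
      constructor
      · rintro ⟨p, hp, -, hc⟩
        simpa using (ih hp (by simp)).1 hc
      · rintro ⟨p, hp, hs⟩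
        obtain ⟨k, hk⟩ := exists_endsAt_iff.2
          ((by simp : (γ ++ [a]).Sublist (γ ++ a :: b :: α)).trans
            (exists_endsAt_iff.1 ⟨p, hp⟩))
        exact ⟨k, hk, hk.le_length.trans_lt hj, (ih hk (by simp)).2
          ⟨p, by simpa using hp, by simpa using hs⟩⟩

theorem condensed_X_iff : Condensed u (α.map (Prod.mk Dir.X)) ↔ α.Sublist u := by
  by_cases hα : α = []
  · simp [hα, Condensed, CondensedIn]
  · exact endsAt_nil.condensedIn_X_iff (Nat.lt_succ_self _) hα

theorem condensed_XY_iff (hα : α ≠ []) (hβ : β ≠ []) :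
    Condensed u (α.map (Prod.mk Dir.X) ++ β.map (Prod.mk Dir.Y)) ↔
      α.Sublist u ∧ PrefixSep α (α.dropLast ++ β.reverse) u := by
  rw [← endsAt_and_sublist_iff hα]
  exact endsAt_nil.condensedIn_XY_iff (Nat.lt_succ_self _) hα hβ

/-- Mere definedness puts no left bound on the `Y`-moves, so `α.dropLast` disappears from the
condition. -/
theorem rankerDefined_XY_iff (hα : α ≠ []) :
    RankerDefined u (α.map (Prod.mk Dir.X) ++ β.map (Prod.mk Dir.Y)) ↔
      α.Sublist u ∧ PrefixSep α β.reverse u := by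
  rw [← endsAt_and_sublist_iff hα]
  have : RankerDefined u (α.map (Prod.mk Dir.X) ++ β.map (Prod.mk Dir.Y)) ↔
      ∃ p, Reach u (α.map (Prod.mk Dir.X) ++ β.map (Prod.mk Dir.Y)) 0 p := by
    cases α with
    | nil => exact absurd rfl hα
    | cons a α => exact Iff.rfl
  rw [this]
  simp only [reach_append, endsAt_nil.reach_iff, List.nil_append, ← reach_Y_iff]
  exact ⟨fun ⟨p, k, h, h'⟩ => ⟨k, h, p, h'⟩, fun ⟨k, h, p, h'⟩ => ⟨p, k, h, h'⟩⟩

end Subwords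

/-! ### Reversal -/

section Reversal

variable {A : Type} {u : List A} {a : A}

/-- The opposite direction. -/
def Dir.flip : Dir → Dir
  | .X => .Y
  | .Y => .X

@[simp] theorem Dir.flip_flip (d : Dir) : d.flip.flip = d := by cases d <;> rfl

/-- The ranker with all directions reversed. -/
def flipRanker (r : Ranker A) : Ranker A := r.map (fun x => (x.1.flip, x.2))

@[simp] theorem flipRanker_flipRanker (r : Ranker A) : flipRanker (flipRanker r) = r := by
  simp [flipRanker, Function.comp_def]

theorem LetterAt.reverse {p : ℕ} (h : LetterAt u p a) :
    LetterAt u.reverse (u.length + 1 - p) a := by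
  have hp := letterAt_le_length h
  obtain ⟨h1, h2⟩ := h
  refine ⟨by omega, ?_⟩
  rw [List.getElem?_reverse (by omega), ← h2]
  congr 1
  omega

theorem letterAt_reverse_iff {p : ℕ} (h1 : p ≤ u.length + 1) :
    LetterAt u.reverse (u.length + 1 - p) a ↔ LetterAt u p a := by
  constructor
  · intro h
    have := h.reverse
    rw [List.reverse_reverse, List.length_reverse] at this
    convert this using 1
    omega
  · exact LetterAt.reverse

theorem IsNext.reverse {d : Dir} {i p : ℕ} (hi : i ≤ u.length + 1) (h : IsNext u d a i p) :
    IsNext u.reverse d.flip a (u.length + 1 - i) (u.length + 1 - p) := by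
  cases d with
  | X =>
    obtain ⟨h1, h2, h3⟩ := h
    have := letterAt_le_length h1
    refine ⟨h1.reverse, by omega, fun s hs hs' hsa => ?_⟩
    have := hsa.reverse
    rw [List.reverse_reverse, List.length_reverse] at this
    exact h3 _ (by omega) (by omega) this
  | Y =>
    obtain ⟨h1, h2, h3⟩ := h
    have := letterAt_le_length h1
    refine ⟨h1.reverse, by omega, fun s hs hs' hsa => ?_⟩
    have := hsa.reverse
    rw [List.reverse_reverse, List.length_reverse] at this
    exact h3 _ (by omega) (by omega) this

theorem CondensedIn.reverse {r : Ranker A} {i j : ℕ} (hi : i ≤ u.length + 1)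
    (hj : j ≤ u.length + 1) (h : CondensedIn u r i j) :
    CondensedIn u.reverse (flipRanker r) (u.length + 1 - j) (u.length + 1 - i) := by
  induction r generalizing i j with
  | nil => trivial
  | cons x r ih =>
    obtain ⟨d, a⟩ := x
    rcases r with _ | ⟨⟨e, b⟩, r⟩
    · cases d
      · obtain ⟨p, hp, hpj⟩ := h
        have := letterAt_le_length hp.1
        exact ⟨_, hp.reverse hi, by omega⟩
      · obtain ⟨p, hp, hpj⟩ := h
        have := letterAt_le_length hp.1
        exact ⟨_, hp.reverse hj, by omega⟩
    · cases d <;> cases e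
      · obtain ⟨p, hp, hpj, hc⟩ := h
        have := letterAt_le_length hp.1
        exact ⟨_, hp.reverse hi, by omega, ih (by omega) hj hc⟩
      · obtain ⟨p, hp, hpj, hc⟩ := h
        have := letterAt_le_length hp.1
        exact ⟨_, hp.reverse hi, by omega, ih hi (by omega) hc⟩
      · obtain ⟨p, hp, hpj, hc⟩ := h
        have := letterAt_le_length hp.1
        exact ⟨_, hp.reverse hj, by omega, ih (by omega) hj hc⟩
      · obtain ⟨p, hp, hpj, hc⟩ := h
        have := letterAt_le_length hp.1
        exact ⟨_, hp.reverse hj, by omega, ih hi (by omega) hc⟩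

/-- The reflection `p ↦ |u| + 1 - p` exchanges the two directions and the two starting points. One
implication suffices, as reversal and flipping are involutions. -/
theorem condensed_reverse_iff {r : Ranker A} :
    Condensed u.reverse (flipRanker r) ↔ Condensed u r := by
  have key : ∀ (u : List A) (r : Ranker A), Condensed u r → Condensed u.reverse (flipRanker r) := by
    intro u r h
    have := CondensedIn.reverse (Nat.zero_le _) le_rfl h
    simpa [Condensed] using this
  exact ⟨fun h => by simpa using key _ _ h, key u r⟩

theorem Reach.reverse {r : Ranker A} {i p : ℕ} (hi : i ≤ u.length + 1) (h : Reach u r i p) :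
    Reach u.reverse (flipRanker r) (u.length + 1 - i) (u.length + 1 - p) := by
  induction r generalizing i with
  | nil => exact congrArg _ h
  | cons x r ih =>
    obtain ⟨k, hk, h⟩ := h
    have : k ≤ u.length := by
      rcases x with ⟨_ | _, a⟩
      · exact letterAt_le_length hk.1
      · exact letterAt_le_length hk.1
    exact ⟨_, hk.reverse hi, ih (by omega) h⟩

theorem rankerDefined_reverse_iff {r : Ranker A} :
    RankerDefined u.reverse (flipRanker r) ↔ RankerDefined u r := by
  have key : ∀ (u : List A) (r : Ranker A), RankerDefined u r →
      RankerDefined u.reverse (flipRanker r) := by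
    intro u r h
    rcases r with _ | ⟨⟨_ | _, a⟩, r⟩
    · trivial
    · obtain ⟨p, h⟩ := h
      have := h.reverse (Nat.zero_le _)
      exact ⟨_, by simpa [startPos, Dir.flip, flipRanker] using this⟩
    · obtain ⟨p, h⟩ := h
      have := h.reverse le_rfl
      exact ⟨_, by simpa [startPos, Dir.flip, flipRanker] using this⟩
  exact ⟨fun h => by simpa using key _ _ h, key u r⟩

theorem flipRanker_two_blocks (d : Dir) (α β : List A) :
    flipRanker (α.map (Prod.mk d) ++ β.map (Prod.mk d.flip)) =
      α.map (Prod.mk d.flip) ++ β.map (Prod.mk d) := by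
  simp [flipRanker, Function.comp_def]

end Reversal

/-! ### Counting blocks -/

section Blocks

variable {α : Type} [DecidableEq α]

theorem blockCount_map {β : Type} [DecidableEq β] {f : α → β} (hf : Function.Injective f)
    (w : List α) : blockCount (w.map f) = blockCount w := by
  unfold blockCount
  have h := congrArg List.length (List.map_destutter_ne (l := w) hf)
  rw [List.length_map] at h
  convert h.symm

theorem length_destutter'_pos (a : α) (w : List α) : 1 ≤ (w.destutter' (· ≠ ·) a).length :=
  List.length_pos_iff.2 (List.destutter'_ne_nil w _)

theorem length_destutter'_cons_le (a b : α) (w : List α) :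
    ((b :: w).destutter' (· ≠ ·) a).length ≤ (w.destutter' (· ≠ ·) b).length + 1 := by
  by_cases h : a = b
  · subst h
    rw [List.destutter'_cons_neg _ (by simp)]
    omega
  · rw [List.destutter'_cons_pos _ h]
    simp

theorem blockCount_cons_le (a : α) (w : List α) : blockCount (a :: w) ≤ blockCount w + 1 := by
  cases w with
  | nil => simp [blockCount]
  | cons b w => exact length_destutter'_cons_le a b w

theorem blockCount_replicate_le (k : ℕ) (a : α) : blockCount (List.replicate k a) ≤ 1 := by
  cases k with
  | zero => simp [blockCount]
  | succ k =>
    induction k with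
    | zero => simp [blockCount]
    | succ k ih =>
      rw [List.replicate_succ] at ih ⊢
      unfold blockCount at ih ⊢
      rw [List.destutter_cons'] at ih ⊢
      rwa [List.replicate_succ, List.destutter'_cons_neg _ (by simp)]

theorem length_destutter'_le_append (a : α) (w w' : List α) :
    (w.destutter' (· ≠ ·) a).length ≤ ((w ++ w').destutter' (· ≠ ·) a).length := by
  induction w generalizing a with
  | nil => exact length_destutter'_pos a w'
  | cons b w ih =>
    by_cases h : a = b
    · subst h
      rw [List.cons_append, List.destutter'_cons_neg _ (by simp),
        List.destutter'_cons_neg _ (by simp)]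
      exact ih a
    · rw [List.cons_append, List.destutter'_cons_pos _ h, List.destutter'_cons_pos _ h]
      simpa using ih b

theorem blockCount_le_append (w w' : List α) : blockCount w ≤ blockCount (w ++ w') := by
  cases w with
  | nil => simp [blockCount]
  | cons a w => exact length_destutter'_le_append a w w'

theorem map_snd_eq_of_one_block {A : Type} {d : Dir} {r : Ranker A}
    (h : ((r.map Prod.fst).destutter' (· ≠ ·) d).length ≤ 1) :
    r = (r.map Prod.snd).map (Prod.mk d) := by
  induction r with
  | nil => rfl
  | cons x r ih =>
    obtain ⟨e, a⟩ := x
    by_cases hde : d = e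
    · subst hde
      rw [List.map_cons, List.destutter'_cons_neg _ (by simp)] at h
      rw [List.map_cons, List.map_cons, ← ih h]
    · rw [List.map_cons, List.destutter'_cons_pos _ hde, List.length_cons] at h
      have : 1 ≤ ((r.map Prod.fst).destutter' (· ≠ ·) e).length :=
        length_destutter'_pos e (r.map Prod.fst)
      simp only at h
      omega

/-- The list `β` may be empty, so this normal form covers one-block rankers too. -/
theorem exists_two_blocks {A : Type} {r : Ranker A} (hr : r ≠ [])
    (h : blockCount (r.map Prod.fst) ≤ 2) :
    ∃ (d : Dir) (α β : List A), α ≠ [] ∧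
      r = α.map (Prod.mk d) ++ β.map (Prod.mk d.flip) := by
  rcases r with _ | ⟨⟨d, a⟩, r⟩
  · exact absurd rfl hr
  · change ((r.map Prod.fst).destutter' (· ≠ ·) d).length ≤ 2 at h
    suffices ∃ α β : List A, r = α.map (Prod.mk d) ++ β.map (Prod.mk d.flip) by
      obtain ⟨α, β, rfl⟩ := this
      exact ⟨d, a :: α, β, by simp, by simp⟩
    clear hr
    induction r with
    | nil => exact ⟨[], [], rfl⟩
    | cons x r ih =>
      obtain ⟨e, b⟩ := x
      by_cases hde : d = e
      · subst hde
        rw [List.map_cons, List.destutter'_cons_neg _ (by simp)] at h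
        obtain ⟨α, β, rfl⟩ := ih h
        exact ⟨b :: α, β, by simp⟩
      · have he : e = d.flip := by cases d <;> cases e <;> simp_all [Dir.flip]
        rw [List.map_cons, List.destutter'_cons_pos _ hde, List.length_cons] at h
        have := map_snd_eq_of_one_block (d := e) (r := r) (by simp only at h; omega)
        refine ⟨[], b :: r.map Prod.snd, ?_⟩
        rw [← he, List.map_cons, ← this]
        rfl

end Blocks

/-! ### Closure properties of the classes of definable languages -/

section Closure

variable {A : Type}

/-- The depth bound is no restriction on a single formula: the sum of the lengths of its finitely
many paths bounds each of them. -/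
theorem mem_FOfrag_iff {m : ℕ} {φ : Formula A} :
    φ ∈ FOfrag A m ↔ ∀ w ∈ φ.pathLabels, blockCount w ≤ m := by
  simp only [FOfrag, FOfragDepth, Set.mem_iUnion, Set.mem_ofPred_eq]
  constructor
  · rintro ⟨n, h⟩ w hw
    exact (h w hw).2
  · intro h
    refine ⟨(φ.pathLabels.map List.length).sum, fun w hw => ⟨?_, h w hw⟩⟩
    exact List.le_sum_of_mem (List.mem_map_of_mem hw)

/-- The dual quantifier. -/
def Quant.dual : Quant → Quant
  | .ex => .all
  | .all => .ex

theorem Quant.dual_injective : Function.Injective Quant.dual := by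
  intro a b h
  cases a <;> cases b <;> simp_all [Quant.dual]

/-- The negation of a formula, pushed to the atomic formulas. -/
def Formula.neg : Formula A → Formula A
  | .letter a x => .notLetter a x
  | .notLetter a x => .letter a x
  | .lt x y => .notLt x y
  | .notLt x y => .lt x y
  | .eq x y => .notEq x y
  | .notEq x y => .eq x y
  | .and φ ψ => .or φ.neg ψ.neg
  | .or φ ψ => .and φ.neg ψ.neg
  | .ex x φ => .all x φ.neg
  | .all x φ => .ex x φ.neg

theorem Formula.sat_neg (u : List A) (φ : Formula A) (v : Fin 2 → ℕ) :
    φ.neg.Sat u v ↔ ¬ φ.Sat u v := by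
  induction φ generalizing v with
  | letter | lt | eq | notEq => simp [neg, Sat]
  | notLetter | notLt => simp [neg, Sat]
  | and φ ψ h h' => simp only [neg, Sat, h, h']; tauto
  | or φ ψ h h' => simp only [neg, Sat, h, h']; tauto
  | ex x φ h => simp only [neg, Sat, h]; push Not; rfl
  | all x φ h => simp only [neg, Sat, h]; push Not; rfl

theorem Formula.freeVars_neg (φ : Formula A) : φ.neg.freeVars = φ.freeVars := by
  induction φ <;> simp_all [neg, freeVars]

theorem Formula.pathLabels_neg (φ : Formula A) :
    φ.neg.pathLabels = φ.pathLabels.map (List.map Quant.dual) := by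
  induction φ <;> simp_all [neg, pathLabels, Quant.dual, Function.comp_def]

/-- The formula for the reversed words. -/
def Formula.rev : Formula A → Formula A
  | .letter a x => .letter a x
  | .notLetter a x => .notLetter a x
  | .lt x y => .lt y x
  | .notLt x y => .notLt y x
  | .eq x y => .eq x y
  | .notEq x y => .notEq x y
  | .and φ ψ => .and φ.rev ψ.rev
  | .or φ ψ => .or φ.rev ψ.rev
  | .ex x φ => .ex x φ.rev
  | .all x φ => .all x φ.rev

theorem Formula.freeVars_rev (φ : Formula A) : φ.rev.freeVars = φ.freeVars := by
  induction φ <;> simp_all [rev, freeVars, Finset.pair_comm]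

theorem Formula.pathLabels_rev (φ : Formula A) : φ.rev.pathLabels = φ.pathLabels := by
  induction φ <;> simp_all [rev, pathLabels]

/-- The hypothesis says that the assignments are mirror images. It allows the values `0` and `|u| +
1` outside the word, as the default assignment of a sentence requires. -/
theorem Formula.sat_rev (u : List A) (φ : Formula A) (v w : Fin 2 → ℕ)
    (h : ∀ x, v x + w x = u.length + 1) : φ.rev.Sat u v ↔ φ.Sat u.reverse w := by
  have hv : ∀ x, w x = u.length + 1 - v x := fun x => by have := h x; omega
  have hle : ∀ x, v x ≤ u.length + 1 := fun x => by have := h x; omega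
  have hup : ∀ {v w : Fin 2 → ℕ}, (∀ x, v x + w x = u.length + 1) → ∀ x {p q : ℕ},
      p + q = u.length + 1 →
      ∀ y, Function.update v x p y + Function.update w x q y = u.length + 1 := by
    intro v w h x p q hpq y
    by_cases hy : y = x
    · subst hy; simpa using hpq
    · simpa [hy] using h y
  induction φ generalizing v w with
  | letter a x => simp only [rev, Sat, hv, letterAt_reverse_iff (hle x)]
  | notLetter a x => simp only [rev, Sat, hv, letterAt_reverse_iff (hle x)]
  | lt x y => have := h x; have := h y; simp only [rev, Sat]; omega
  | notLt x y => have := h x; have := h y; simp only [rev, Sat]; omega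
  | eq x y => have := h x; have := h y; simp only [rev, Sat]; omega
  | notEq x y => have := h x; have := h y; simp only [rev, Sat]; omega
  | and φ ψ ih ih' => simp only [rev, Sat, ih v w h hv hle, ih' v w h hv hle]
  | or φ ψ ih ih' => simp only [rev, Sat, ih v w h hv hle, ih' v w h hv hle]
  | ex x φ ih =>
    simp only [rev, Sat, List.length_reverse]
    constructor
    · rintro ⟨p, h1, h2, hp⟩
      have h' := hup h x (p := p) (q := u.length + 1 - p) (by omega)
      exact ⟨u.length + 1 - p, by omega, by omega, (ih _ _ h'
        (fun y => by have := h' y; omega) (fun y => by have := h' y; omega)).1 hp⟩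
    · rintro ⟨p, h1, h2, hp⟩
      have h' := hup h x (p := u.length + 1 - p) (q := p) (by omega)
      exact ⟨u.length + 1 - p, by omega, by omega, (ih _ _ h'
        (fun y => by have := h' y; omega) (fun y => by have := h' y; omega)).2 hp⟩
  | all x φ ih =>
    simp only [rev, Sat, List.length_reverse]
    constructor
    · intro hp p h1 h2
      have h' := hup h x (p := u.length + 1 - p) (q := p) (by omega)
      exact (ih _ _ h' (fun y => by have := h' y; omega)
        (fun y => by have := h' y; omega)).1 (hp _ (by omega) (by omega))
    · intro hp p h1 h2
      have h' := hup h x (p := p) (q := u.length + 1 - p) (by omega)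
      exact (ih _ _ h' (fun y => by have := h' y; omega)
        (fun y => by have := h' y; omega)).2 (hp _ (by omega) (by omega))

theorem Formula.sat_congr (u : List A) (φ : Formula A) {v w : Fin 2 → ℕ}
    (h : ∀ x ∈ φ.freeVars, v x = w x) : φ.Sat u v ↔ φ.Sat u w := by
  have hup : ∀ {x : Fin 2} {φ : Formula A} {v w : Fin 2 → ℕ},
      (∀ y ∈ φ.freeVars.erase x, v y = w y) →
      ∀ p, ∀ y ∈ φ.freeVars, Function.update v x p y = Function.update w x p y := by
    intro x φ v w h p y hy
    by_cases hyx : y = x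
    · subst hyx; simp
    · simpa [hyx] using h y (Finset.mem_erase.2 ⟨hyx, hy⟩)
  induction φ generalizing v w with
  | letter a x => simp [Sat, h x (by simp [freeVars])]
  | notLetter a x => simp [Sat, h x (by simp [freeVars])]
  | lt x y => simp [Sat, h x (by simp [freeVars]), h y (by simp [freeVars])]
  | notLt x y => simp [Sat, h x (by simp [freeVars]), h y (by simp [freeVars])]
  | eq x y => simp [Sat, h x (by simp [freeVars]), h y (by simp [freeVars])]
  | notEq x y => simp [Sat, h x (by simp [freeVars]), h y (by simp [freeVars])]
  | and φ ψ ih ih' =>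
    simp only [Sat, ih fun x hx => h x (Finset.mem_union_left _ hx),
      ih' fun x hx => h x (Finset.mem_union_right _ hx)]
  | or φ ψ ih ih' =>
    simp only [Sat, ih fun x hx => h x (Finset.mem_union_left _ hx),
      ih' fun x hx => h x (Finset.mem_union_right _ hx)]
  | ex x φ ih => simp only [Sat, fun p => ih (hup h p)]
  | all x φ ih => simp only [Sat, fun p => ih (hup h p)]

variable [Finite A] {m : ℕ}

theorem compl_mem_FOLang {K : Language A} (hK : K ∈ FOLang m A) :
    ({u | u ∉ K} : Language A) ∈ FOLang m A := by
  obtain ⟨φ, hφ, hf, hK⟩ := hK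
  refine ⟨φ.neg, mem_FOfrag_iff.2 ?_, φ.freeVars_neg.trans hf, fun u => ?_⟩
  · rw [φ.pathLabels_neg]
    intro w hw
    obtain ⟨w', hw', rfl⟩ := List.mem_map.1 hw
    rw [blockCount_map Quant.dual_injective]
    exact mem_FOfrag_iff.1 hφ w' hw'
  · rw [φ.sat_neg, ← hK]
    rfl

theorem inter_mem_FOLang {K K' : Language A} (hK : K ∈ FOLang m A) (hK' : K' ∈ FOLang m A) :
    ({u | u ∈ K ∧ u ∈ K'} : Language A) ∈ FOLang m A := by
  obtain ⟨φ, hφ, hf, hK⟩ := hK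
  obtain ⟨ψ, hψ, hf', hK'⟩ := hK'
  refine ⟨.and φ ψ, mem_FOfrag_iff.2 ?_, by simp [Formula.freeVars, hf, hf'], fun u => ?_⟩
  · intro w hw
    rcases List.mem_append.1 hw with hw | hw
    · exact mem_FOfrag_iff.1 hφ w hw
    · exact mem_FOfrag_iff.1 hψ w hw
  · rw [Formula.Sat, ← hK, ← hK']
    rfl

theorem union_mem_FOLang {K K' : Language A} (hK : K ∈ FOLang m A) (hK' : K' ∈ FOLang m A) :
    ({u | u ∈ K ∨ u ∈ K'} : Language A) ∈ FOLang m A := by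
  convert compl_mem_FOLang (inter_mem_FOLang (compl_mem_FOLang hK) (compl_mem_FOLang hK')) using 1
  ext u
  change (u ∈ K ∨ u ∈ K') ↔ ¬ (¬ u ∈ K ∧ ¬ u ∈ K')
  tauto

theorem const_mem_FOLang (hm : 1 ≤ m) (P : Prop) : ({_u | P} : Language A) ∈ FOLang m A := by
  have h : ({_u | True} : Language A) ∈ FOLang m A := by
    -- There are no truth constants, so a sentence needs a quantifier, whence `1 ≤ m`. The universal
    -- one is also true in the empty word.
    refine ⟨.all 0 (.eq 0 0), mem_FOfrag_iff.2 ?_, by simp [Formula.freeVars], fun u => ?_⟩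
    · simpa [Formula.pathLabels, blockCount] using hm
    · simp only [Formula.Sat, implies_true, iff_true]
      exact trivial
  by_cases hP : P
  · simpa only [hP] using h
  · convert compl_mem_FOLang h using 1
    ext u
    change P ↔ ¬ True
    tauto

theorem reverse_mem_FOLang {K : Language A} (hK : K ∈ FOLang m A) :
    ({u | u.reverse ∈ K} : Language A) ∈ FOLang m A := by
  obtain ⟨φ, hφ, hf, hK⟩ := hK
  refine ⟨φ.rev, mem_FOfrag_iff.2 ?_, φ.freeVars_rev.trans hf, fun u => ?_⟩
  · rw [φ.pathLabels_rev]
    exact mem_FOfrag_iff.1 hφ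
  · change u.reverse ∈ K ↔ _
    -- The mirror image of the default assignment `0` is `|u| + 1`; the sentence does not depend on
    -- the difference.
    rw [hK, ← φ.sat_rev u (fun _ => u.length + 1) _ (fun _ => rfl)]
    exact φ.rev.sat_congr u (by simp [φ.freeVars_rev, hf])

/-- A language that does not separate words which agree on finitely many definable languages is
definable. -/
theorem mem_FOLang_of_saturated {ι : Type} (hm : 1 ≤ m) {S : Set ι} (hS : S.Finite)
    {F : ι → Language A} (hF : ∀ i ∈ S, F i ∈ FOLang m A) {K : Language A}
    (hK : ∀ u v, (∀ i ∈ S, u ∈ F i ↔ v ∈ F i) → u ∈ K → v ∈ K) : K ∈ FOLang m A := by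
  induction S, hS using Set.Finite.induction_on generalizing K with
  | empty =>
    have h : K = {_u | [] ∈ K} := by
      ext u
      exact ⟨hK _ _ (by simp), hK _ _ (by simp)⟩
    rw [h]
    exact const_mem_FOLang hm _
  | @insert i S _ _ ih =>
    -- The language `F i` cuts `K` into two parts. The saturation of either part under agreement on
    -- `S` is covered by the induction hypothesis, and intersecting it with `F i` or its complement
    -- gives the part back.
    have h1 : ∀ P : Prop, ({u | ∃ v ∈ K, (v ∈ F i ↔ P) ∧ ∀ j ∈ S, v ∈ F j ↔ u ∈ F j} :
        Language A) ∈ FOLang m A := by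
      intro P
      refine ih (fun j hj => hF j (Set.mem_insert_of_mem _ hj)) ?_
      rintro u u' huu ⟨v, hv, hvP, hvu⟩
      exact ⟨v, hv, hvP, fun j hj => (hvu j hj).trans (huu j hj)⟩
    have hi := hF i (Set.mem_insert _ _)
    suffices h : K = {u | u ∈ ({u | u ∈ F i ∧ u ∈ ({u | ∃ v ∈ K, (v ∈ F i ↔ True) ∧
        ∀ j ∈ S, v ∈ F j ↔ u ∈ F j} : Language A)} : Language A) ∨
        u ∈ ({u | u ∈ ({u | u ∉ F i} : Language A) ∧ u ∈ ({u | ∃ v ∈ K, (v ∈ F i ↔ False) ∧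
        ∀ j ∈ S, v ∈ F j ↔ u ∈ F j} : Language A)} : Language A)} by
      rw [h]
      exact union_mem_FOLang (inter_mem_FOLang hi (h1 True))
        (inter_mem_FOLang (compl_mem_FOLang hi) (h1 False))
    ext u
    change u ∈ K ↔ (u ∈ F i ∧ ∃ v ∈ K, (v ∈ F i ↔ True) ∧ ∀ j ∈ S, v ∈ F j ↔ u ∈ F j) ∨
      (u ∉ F i ∧ ∃ v ∈ K, (v ∈ F i ↔ False) ∧ ∀ j ∈ S, v ∈ F j ↔ u ∈ F j)
    constructor
    · intro hu
      by_cases hui : u ∈ F i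
      · exact Or.inl ⟨hui, u, hu, by simpa using hui, fun _ _ => Iff.rfl⟩
      · exact Or.inr ⟨hui, u, hu, by simpa using hui, fun _ _ => Iff.rfl⟩
    · rintro (⟨hui, v, hv, hvi, hvu⟩ | ⟨hui, v, hv, hvi, hvu⟩)
      · refine hK v u (fun j hj => ?_) hv
        rcases hj with rfl | hj
        · tauto
        · exact hvu j hj
      · refine hK v u (fun j hj => ?_) hv
        rcases hj with rfl | hj
        · tauto
        · exact hvu j hj

end Closure

/-! ### Definability of rankers with at most two blocks -/

section Definability

variable {A : Type}

/-- The letters of `δ` occur, from right to left, at positions before the variable `x`. -/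
def chainBefore : List A → Fin 2 → Formula A
  | [], x => .eq x x
  | b :: δ, x => .ex (1 - x) (.and (.lt (1 - x) x) (.and (.letter b (1 - x))
      (chainBefore δ (1 - x))))

/-- Two variables suffice because only the current position matters for the rest of the chain, so
the other variable can be requantified. -/
theorem sat_chainBefore (u : List A) (δ : List A) (x : Fin 2) (v : Fin 2 → ℕ) :
    (chainBefore δ x).Sat u v ↔ δ.reverse.Sublist (u.take (v x - 1)) := by
  induction δ generalizing x v with
  | nil => simp [chainBefore, Formula.Sat]
  | cons b δ ih =>
    have hx : x ≠ 1 - x := by revert x; decide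
    simp only [chainBefore, Formula.Sat, ih, Function.update_self, Function.update_of_ne hx,
      List.reverse_cons, concat_sublist_take_iff]
    constructor
    · rintro ⟨p, h1, h2, h3, h4, h5⟩
      exact ⟨p, by omega, h4, h5⟩
    · rintro ⟨p, h1, h2, h3⟩
      have := h2.1
      exact ⟨p, h2.1, letterAt_le_length h2, by omega, h2, h3⟩

theorem freeVars_chainBefore (δ : List A) (x : Fin 2) : (chainBefore δ x).freeVars = {x} := by
  induction δ generalizing x with
  | nil => simp [chainBefore, Formula.freeVars]
  | cons b δ ih =>
    simp only [chainBefore, Formula.freeVars, ih]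
    revert x
    decide

theorem blockCount_ex_cons {w : List Quant} {k : ℕ} (h : w = List.replicate k .ex) :
    blockCount (Quant.ex :: w) ≤ 1 := by
  rw [h, ← List.replicate_succ]
  exact blockCount_replicate_le _ _

theorem pathLabels_chainBefore {δ : List A} {x : Fin 2} {w : List Quant}
    (hw : w ∈ (chainBefore δ x).pathLabels) : ∃ k, w = List.replicate k .ex := by
  induction δ generalizing x w with
  | nil => exact ⟨0, by simpa [chainBefore, Formula.pathLabels] using hw⟩
  | cons b δ ih =>
    simp only [chainBefore, Formula.pathLabels, List.mem_map, List.mem_append,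
      List.mem_singleton] at hw
    obtain ⟨w, (rfl | rfl | hw), rfl⟩ := hw
    · exact ⟨1, rfl⟩
    · exact ⟨1, rfl⟩
    · obtain ⟨k, rfl⟩ := ih hw
      exact ⟨k + 1, rfl⟩

/-- The letters of `δ` occur, from right to left, at positions up to the variable `0`. -/
def chainUpTo : List A → Formula A
  | [] => .eq 0 0
  | b :: δ => .or (.and (.letter b 0) (chainBefore δ 0)) (chainBefore (b :: δ) 0)

theorem sat_chainUpTo (u : List A) (δ : List A) (v : Fin 2 → ℕ) :
    (chainUpTo δ).Sat u v ↔ δ.reverse.Sublist (u.take (v 0)) := by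
  cases δ with
  | nil => simp [chainUpTo, Formula.Sat]
  | cons b δ =>
    simp only [chainUpTo, Formula.Sat, sat_chainBefore, List.reverse_cons,
      concat_sublist_take_iff]
    constructor
    · rintro (⟨h, h'⟩ | ⟨p, hp, h⟩)
      · exact ⟨_, le_rfl, h, h'⟩
      · exact ⟨p, by omega, h⟩
    · rintro ⟨p, hp, h, h'⟩
      rcases hp.lt_or_eq with hlt | rfl
      · exact Or.inr ⟨p, by omega, h, h'⟩
      · exact Or.inl ⟨h, h'⟩

theorem freeVars_chainUpTo (δ : List A) : (chainUpTo δ).freeVars = {0} := by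
  cases δ <;> simp [chainUpTo, Formula.freeVars, freeVars_chainBefore]

theorem pathLabels_chainUpTo {δ : List A} {w : List Quant}
    (hw : w ∈ (chainUpTo δ).pathLabels) : ∃ k, w = List.replicate k .ex := by
  cases δ with
  | nil => exact ⟨0, by simpa [chainUpTo, Formula.pathLabels] using hw⟩
  | cons b δ =>
    simp only [chainUpTo, Formula.pathLabels, List.mem_append, List.mem_singleton] at hw
    rcases hw with (rfl | hw) | hw
    · exact ⟨0, rfl⟩
    · exact pathLabels_chainBefore hw
    · exact pathLabels_chainBefore hw

variable [Finite A]

/-- The initial `∃` chooses the end of the prefix. The chain for `γ` continues the existential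
block; the negated chain for `α` is purely universal and adds one block. -/
theorem prefixSep_mem_FOLang (α : List A) {γ : List A} (hγ : γ ≠ []) :
    ({u | PrefixSep α γ u} : Language A) ∈ FOLang 2 A := by
  refine ⟨.ex 0 (.and (chainUpTo γ.reverse) (chainUpTo α.reverse).neg), mem_FOfrag_iff.2 ?_,
    by simp [Formula.freeVars, freeVars_chainUpTo, Formula.freeVars_neg], fun u => ?_⟩
  · intro w hw
    simp only [Formula.pathLabels, Formula.pathLabels_neg, List.mem_map, List.mem_append] at hw
    obtain ⟨w, (hw | ⟨w, hw, rfl⟩), rfl⟩ := hw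
    · obtain ⟨k, hk⟩ := pathLabels_chainUpTo hw
      have := blockCount_ex_cons hk
      omega
    · obtain ⟨k, rfl⟩ := pathLabels_chainUpTo hw
      have h1 := blockCount_cons_le Quant.ex ((List.replicate k Quant.ex).map Quant.dual)
      rw [List.map_replicate] at h1 ⊢
      have h2 := blockCount_replicate_le k Quant.ex.dual
      omega
  · simp only [Formula.Sat, Formula.sat_neg, sat_chainUpTo, List.reverse_reverse,
      Function.update_self]
    change PrefixSep α γ u ↔ _
    constructor
    · rintro ⟨q, h, h'⟩
      -- The quantifier ranges over positions only, so the witness must be neither `0`, which `γ ≠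
      -- []` excludes, nor larger than `|u|`, in which case `|u|` replaces it.
      have h0 : q ≠ 0 := by rintro rfl; simp [hγ] at h
      rcases Nat.le_total q u.length with hq | hq
      · exact ⟨q, by omega, hq, h, h'⟩
      · rw [List.take_of_length_le hq] at h h'
        refine ⟨u.length, List.length_pos_iff.2 ?_, le_rfl, ?_, ?_⟩
        · rintro rfl
          exact hγ (List.sublist_nil.1 h)
        · rwa [List.take_length]
        · rwa [List.take_length]
    · rintro ⟨q, -, -, h⟩
      exact ⟨q, h⟩

theorem sublist_mem_FOLang (α : List A) : ({u | α.Sublist u} : Language A) ∈ FOLang 2 A := by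
  rcases List.eq_nil_or_concat' α with rfl | ⟨α, a, rfl⟩
  · simpa using const_mem_FOLang (A := A) (m := 2) (by omega) True
  · refine ⟨.ex 0 (chainUpTo (α ++ [a]).reverse), mem_FOfrag_iff.2 ?_,
      by simp [Formula.freeVars, freeVars_chainUpTo], fun u => ?_⟩
    · intro w hw
      simp only [Formula.pathLabels, List.mem_map] at hw
      obtain ⟨w, hw, rfl⟩ := hw
      obtain ⟨k, hk⟩ := pathLabels_chainUpTo hw
      have := blockCount_ex_cons hk
      omega
    · simp only [Formula.Sat, sat_chainUpTo, List.reverse_reverse, Function.update_self]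
      change (α ++ [a]).Sublist u ↔ _
      constructor
      · intro h
        refine ⟨u.length, List.length_pos_iff.2 ?_, le_rfl, by rwa [List.take_length]⟩
        rintro rfl
        simp at h
      · rintro ⟨p, -, -, h⟩
        exact h.trans (List.take_sublist _ _)

/-- Definability of a ranker property that is invariant under reversal and that is known for
`X`-rankers and for rankers with an `X`-block followed by a `Y`-block. -/
theorem ranker_mem_FOLang {P : List A → Ranker A → Prop}
    (hrev : ∀ u r, P u.reverse (flipRanker r) ↔ P u r)
    (hP : ∀ α β : List A, α ≠ [] →
      ({u | P u (α.map (Prod.mk .X) ++ β.map (Prod.mk .Y))} : Language A) ∈ FOLang 2 A)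
    {r : Ranker A} (hr : r ≠ []) (h : blockCount (r.map Prod.fst) ≤ 2) :
    ({u | P u r} : Language A) ∈ FOLang 2 A := by
  obtain ⟨d, α, β, hα, rfl⟩ := exists_two_blocks hr h
  cases d with
  | X => exact hP α β hα
  | Y =>
    convert reverse_mem_FOLang (hP α β hα) using 1
    ext u
    change P u _ ↔ P u.reverse _
    rw [← hrev, flipRanker_two_blocks]
    rfl

theorem condensed_mem_FOLang {r : Ranker A} (hr : r ≠ []) (h : blockCount (r.map Prod.fst) ≤ 2) :
    ({u | Condensed u r} : Language A) ∈ FOLang 2 A := by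
  refine ranker_mem_FOLang (fun u r => condensed_reverse_iff) (fun α β hα => ?_) hr h
  by_cases hβ : β = []
  · simpa only [hβ, List.map_nil, List.append_nil, condensed_X_iff] using sublist_mem_FOLang α
  · simp only [condensed_XY_iff hα hβ]
    exact inter_mem_FOLang (sublist_mem_FOLang α) (prefixSep_mem_FOLang α (by simp [hβ]))

theorem rankerDefined_mem_FOLang {r : Ranker A} (hr : r ≠ [])
    (h : blockCount (r.map Prod.fst) ≤ 2) : ({u | RankerDefined u r} : Language A) ∈ FOLang 2 A := by
  refine ranker_mem_FOLang (fun u r => rankerDefined_reverse_iff) (fun α β hα => ?_) hr h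
  simp only [rankerDefined_XY_iff hα]
  by_cases hβ : β = []
  · have : ∀ u, α.Sublist u → PrefixSep α [] u := fun u _ => ⟨0, by simp, by simpa using hα⟩
    have : ∀ u, α.Sublist u ∧ PrefixSep α [] u ↔ α.Sublist u := fun u => ⟨And.left, fun h => ⟨h, this u h⟩⟩
    simpa only [hβ, List.reverse_nil, this] using sublist_mem_FOLang α
  · exact inter_mem_FOLang (sublist_mem_FOLang α) (prefixSep_mem_FOLang α (by simp [hβ]))

end Definability

/-! ### Temporal formulas only see which rankers are defined -/

section Temporal

variable {A : Type}

/-- `u` and `v` agree on the rankers in `S` being defined. -/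
def DefAgree (S : Set (Ranker A)) (u v : List A) : Prop :=
  ∀ r ∈ S, RankerDefined u r ↔ RankerDefined v r

/-- The rankers of depth at most `n` with at most two blocks. -/
def twoBlockRankers (A : Type) (n : ℕ) : Set (Ranker A) :=
  {r | r ≠ [] ∧ r.length ≤ n ∧ blockCount (r.map Prod.fst) ≤ 2}

theorem finite_rankers_length_le [Finite A] (n : ℕ) : {r : Ranker A | r.length ≤ n}.Finite := by
  have : Finite Dir := Finite.of_surjective (fun b : Bool => if b then Dir.X else Dir.Y) (by
    rintro (_ | _)
    · exact ⟨true, rfl⟩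
    · exact ⟨false, rfl⟩)
  exact List.finite_length_le _ n

theorem finite_twoBlockRankers [Finite A] (n : ℕ) : (twoBlockRankers A n).Finite :=
  (finite_rankers_length_le n).subset fun _ h => h.2.1

theorem IsNext.unique {u : List A} {d : Dir} {a : A} {i k l : ℕ} (hk : IsNext u d a i k)
    (hl : IsNext u d a i l) : k = l := by
  cases d
  · rcases lt_trichotomy k l with h | h | h
    · exact absurd hk.1 (hl.2.2 _ hk.2.1 h)
    · exact h
    · exact absurd hl.1 (hk.2.2 _ hl.2.1 h)
  · rcases lt_trichotomy k l with h | h | h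
    · exact absurd hl.1 (hk.2.2 _ h hl.2.1)
    · exact h
    · exact absurd hk.1 (hl.2.2 _ h hk.2.1)

theorem Reach.unique {u : List A} {r : Ranker A} {i p q : ℕ} (hp : Reach u r i p)
    (hq : Reach u r i q) : p = q := by
  induction r generalizing i with
  | nil => exact Eq.trans hp (Eq.symm hq)
  | cons x r ih =>
    obtain ⟨k, hk, hp⟩ := hp
    obtain ⟨l, hl, hq⟩ := hq
    obtain rfl := hk.unique hl
    exact ih hp hq

theorem TLFormula.pathLabels_ne_nil (φ : TLFormula A) : φ.pathLabels ≠ [] := by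
  induction φ <;> simp_all [pathLabels]

variable {n : ℕ} {u v : List A}

/-- The ranker extended by one move is still in the agreement set, hence defined on `v`; since
rankers are deterministic, its run there passes through `p'`. -/
theorem DefAgree.exists_isNext (h : DefAgree (twoBlockRankers A n) u v) {e d : Dir} {b a : A}
    {r : Ranker A} {p p' k : ℕ} (hp : Reach u ((e, b) :: r) (startPos u e) p)
    (hp' : Reach v ((e, b) :: r) (startPos v e) p') (hk : IsNext u d a p k)
    (hn : r.length + 2 ≤ n)
    (hb : blockCount (((e, b) :: r ++ [(d, a)]).map Prod.fst) ≤ 2) :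
    ∃ k', IsNext v d a p' k' ∧ Reach u ((e, b) :: r ++ [(d, a)]) (startPos u e) k ∧
      Reach v ((e, b) :: r ++ [(d, a)]) (startPos v e) k' := by
  have h1 : Reach u ((e, b) :: r ++ [(d, a)]) (startPos u e) k :=
    reach_append.2 ⟨p, hp, k, hk, rfl⟩
  obtain ⟨k', hk'⟩ : RankerDefined v ((e, b) :: r ++ [(d, a)]) :=
    (h _ ⟨by simp, by simp; omega, hb⟩).1 ⟨k, h1⟩
  obtain ⟨q, hq, l, hl, hlk⟩ := (reach_append (r := (e, b) :: r)).1 hk'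
  obtain rfl := hq.unique hp'
  obtain rfl : k' = l := hlk
  exact ⟨k', hl, h1, hk'⟩

theorem DefAgree.symm {S : Set (Ranker A)} (h : DefAgree S u v) : DefAgree S v u :=
  fun r hr => (h r hr).symm

/-- Formulas are evaluated at positions reached by one ranker on both words, and each operator
lengthens this ranker. The invariant bounds the ranker together with every remaining branch of the
formula. -/
theorem DefAgree.satAt_iff (h : DefAgree (twoBlockRankers A n) u v) (φ : TLFormula A) {e : Dir}
    {b : A} {r : Ranker A} {p p' : ℕ} (hp : Reach u ((e, b) :: r) (startPos u e) p)
    (hp' : Reach v ((e, b) :: r) (startPos v e) p')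
    (hφ : ∀ w ∈ φ.pathLabels, r.length + 1 + w.length ≤ n ∧
      blockCount (((e, b) :: r).map Prod.fst ++ w) ≤ 2) : φ.SatAt u p ↔ φ.SatAt v p' := by
  induction φ generalizing r p p' with
  | top => exact Iff.rfl
  | not φ ih => exact not_congr (ih hp hp' hφ)
  | and φ ψ ih ih' =>
    exact and_congr (ih hp hp' fun w hw => hφ w (List.mem_append_left _ hw))
      (ih' hp hp' fun w hw => hφ w (List.mem_append_right _ hw))
  | or φ ψ ih ih' =>
    exact or_congr (ih hp hp' fun w hw => hφ w (List.mem_append_left _ hw))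
      (ih' hp hp' fun w hw => hφ w (List.mem_append_right _ hw))
  | next d a φ ih =>
    have hφ' : ∀ w ∈ φ.pathLabels, (r ++ [(d, a)]).length + 1 + w.length ≤ n ∧
        blockCount (((e, b) :: (r ++ [(d, a)])).map Prod.fst ++ w) ≤ 2 := by
      intro w hw
      obtain ⟨h1, h2⟩ := hφ (d :: w) (List.mem_map_of_mem hw)
      refine ⟨?_, by simpa using h2⟩
      simp only [List.length_cons, List.length_append, List.length_nil] at h1 ⊢
      omega
    -- Every formula has a branch, so the bound on ranker plus branch yields a bound on the extended
    -- ranker itself.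
    obtain ⟨w, hw⟩ := List.exists_mem_of_ne_nil _ φ.pathLabels_ne_nil
    obtain ⟨h1, h2⟩ := hφ' w hw
    have h2 := (blockCount_le_append _ _).trans h2
    simp only [List.length_append, List.length_singleton] at h1
    constructor
    · rintro ⟨k, hk, hs⟩
      obtain ⟨k', hk', hr, hr'⟩ := h.exists_isNext hp hp' hk (by omega) h2
      exact ⟨k', hk', (ih hr hr' hφ').1 hs⟩
    · rintro ⟨k', hk', hs⟩
      obtain ⟨k, hk, hr', hr⟩ := h.symm.exists_isNext hp' hp hk' (by omega) h2
      exact ⟨k, hk, (ih hr hr' hφ').2 hs⟩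

theorem DefAgree.sat_iff (h : DefAgree (twoBlockRankers A n) u v) (φ : TLFormula A)
    (hφ : ∀ w ∈ φ.pathLabels, w.length ≤ n ∧ blockCount w ≤ 2) : φ.Sat u ↔ φ.Sat v := by
  induction φ with
  | top => exact Iff.rfl
  | not φ ih => exact not_congr (ih hφ)
  | and φ ψ ih ih' =>
    exact and_congr (ih fun w hw => hφ w (List.mem_append_left _ hw))
      (ih' fun w hw => hφ w (List.mem_append_right _ hw))
  | or φ ψ ih ih' =>
    exact or_congr (ih fun w hw => hφ w (List.mem_append_left _ hw))
      (ih' fun w hw => hφ w (List.mem_append_right _ hw))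
  | next d a φ ih =>
    have key : ∀ {u v : List A}, DefAgree (twoBlockRankers A n) u v →
        (TLFormula.next d a φ).SatAt u (startPos u d) →
        (TLFormula.next d a φ).SatAt v (startPos v d) := by
      rintro u v h ⟨k, hk, hs⟩
      have hφ' : ∀ w ∈ φ.pathLabels, ([] : Ranker A).length + 1 + w.length ≤ n ∧
          blockCount ([(d, a)].map Prod.fst ++ w) ≤ 2 := by
        intro w hw
        obtain ⟨h1, h2⟩ := hφ (d :: w) (List.mem_map_of_mem hw)
        refine ⟨?_, h2⟩
        simp only [List.length_cons, List.length_nil] at h1 ⊢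
        omega
      obtain ⟨w, hw⟩ := List.exists_mem_of_ne_nil _ φ.pathLabels_ne_nil
      obtain ⟨h1, h2⟩ := hφ' w hw
      have h2 := (blockCount_le_append _ _).trans h2
      simp only [List.length_nil] at h1
      have hr : Reach u [(d, a)] (startPos u d) k := ⟨k, hk, rfl⟩
      obtain ⟨k', hr'⟩ : RankerDefined v [(d, a)] :=
        (h _ ⟨by simp, by simp; omega, h2⟩).1 ⟨k, hr⟩
      obtain ⟨l, hl, hlk⟩ := hr'
      obtain rfl : k' = l := hlk
      exact ⟨k', hl, (h.satAt_iff φ hr ⟨k', hl, rfl⟩ hφ').1 hs⟩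
    cases d
    · exact ⟨key h, key h.symm⟩
    · exact ⟨key h, key h.symm⟩

/-- A `TL_2`-language does not separate words that agree on the definedness of all rankers with
at most two blocks and depth at most some `n`. -/
theorem exists_defAgree_of_mem_TLLang [Finite A] {K : Language A} (hK : K ∈ TLLang 2 A) :
    ∃ n, ∀ u v, DefAgree (twoBlockRankers A n) u v → (u ∈ K ↔ v ∈ K) := by
  obtain ⟨φ, hφ, hK⟩ := hK
  refine ⟨(φ.pathLabels.map List.length).sum, fun u v h => ?_⟩
  rw [hK, hK]
  exact h.sat_iff φ fun w hw => ⟨List.le_sum_of_mem (List.mem_map_of_mem hw), hφ w hw⟩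

theorem TLLang_subset_FOLang (A : Type) [Finite A] : TLLang 2 A ⊆ FOLang 2 A := by
  intro K hK
  obtain ⟨n, hn⟩ := exists_defAgree_of_mem_TLLang hK
  exact mem_FOLang_of_saturated (by omega) (finite_twoBlockRankers n)
    (F := fun r => {u | RankerDefined u r})
    (fun r hr => rankerDefined_mem_FOLang hr.1 hr.2.2) fun u v h => (hn u v h).1

end Temporal

/-! ### Words that agree on all rankers with at most two blocks -/

section Words

variable {A : Type}

/-- The power `w ^ N` of a word. -/
def wordPow (w : List A) (N : ℕ) : List A := (List.replicate N w).flatten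

theorem wordPow_succ (w : List A) (N : ℕ) : wordPow w (N + 1) = w ++ wordPow w N := by
  simp [wordPow, List.replicate_succ]

theorem toList_pow (w : FreeMonoid A) (N : ℕ) : (w ^ N).toList = wordPow w.toList N := by
  induction N with
  | zero => rfl
  | succ N ih => rw [pow_succ', FreeMonoid.toList_mul, ih, wordPow_succ]

theorem mem_of_mem_wordPow {w : List A} {N : ℕ} {a : A} (h : a ∈ wordPow w N) : a ∈ w := by
  obtain ⟨l, hl, ha⟩ := List.mem_flatten.1 h
  rwa [List.eq_of_mem_replicate hl] at ha

theorem wordPow_reverse (w : List A) (N : ℕ) : (wordPow w N).reverse = wordPow w.reverse N := by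
  simp [wordPow, List.reverse_flatten]

theorem sublist_wordPow {w γ : List A} {N : ℕ} (hN : γ.length ≤ N) (h : ∀ a ∈ γ, a ∈ w) :
    γ.Sublist (wordPow w N) := by
  induction γ generalizing N with
  | nil => exact List.nil_sublist _
  | cons a γ ih =>
    obtain ⟨N, rfl⟩ : ∃ M, N = M + 1 := ⟨N - 1, by simp at hN; omega⟩
    rw [wordPow_succ, ← List.singleton_append]
    exact (List.singleton_sublist.2 (h a (by simp))).append
      (ih (by simpa using hN) fun b hb => h b (by simp [hb]))

/-- `u` and `v` have the same scattered subwords of length at most `n`. -/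
def SameSubwords (n : ℕ) (u v : List A) : Prop :=
  ∀ γ : List A, γ.length ≤ n → (γ.Sublist u ↔ γ.Sublist v)

/-- The part of `γ` embedded in the power and `y` uses letters of `w` only and is no longer than
`N`, so the power alone accommodates it, one letter per copy. -/
theorem sameSubwords_insert {w y : List A} {n N : ℕ} (hn : n ≤ N) (hy : ∀ a ∈ y, a ∈ w)
    (t : List A) : SameSubwords n (wordPow w N ++ t) (wordPow w N ++ y ++ t) := by
  intro γ hγ
  constructor
  · exact fun h => h.trans ((List.sublist_append_left _ _).append (List.Sublist.refl t))
  · intro h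
    obtain ⟨γ₁, γ₂, rfl, h₁, h₂⟩ := List.sublist_append_iff.1 h
    refine (sublist_wordPow (by simp at hγ; omega) fun a ha => ?_).append h₂
    rcases List.mem_append.1 (h₁.subset ha) with h | h
    · exact mem_of_mem_wordPow h
    · exact hy a h

/-- Cuts inside the power are unaffected, and cuts beyond it are shifted past `y`; the corresponding
prefixes have the same short subwords. -/
theorem prefixSep_insert_iff {w y t α γ : List A} {n N : ℕ} (hn : n ≤ N) (hy : ∀ a ∈ y, a ∈ w)
    (hα : α.length ≤ n) (hγ : γ.length ≤ n) :
    PrefixSep α γ (wordPow w N ++ t) ↔ PrefixSep α γ (wordPow w N ++ y ++ t) := by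
  have hS : ∀ {u v}, SameSubwords n u v → (γ.Sublist u ∧ ¬ α.Sublist u ↔
      γ.Sublist v ∧ ¬ α.Sublist v) := fun h => and_congr (h γ hγ) (not_congr (h α hα))
  set P := wordPow w N with hP
  constructor
  · rintro ⟨q, hq⟩
    rcases Nat.le_total q P.length with h | h
    · refine ⟨q, ?_⟩
      rw [List.append_assoc, List.take_append_of_le_length h]
      rwa [List.take_append_of_le_length h] at hq
    · obtain ⟨k, rfl⟩ := Nat.exists_eq_add_of_le h
      refine ⟨(P ++ y).length + k, ?_⟩
      rw [List.take_length_add_append] at hq ⊢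
      exact (hS (sameSubwords_insert hn hy _)).1 hq
  · rintro ⟨q, hq⟩
    rcases Nat.le_total q P.length with h | h
    · refine ⟨q, ?_⟩
      rw [List.append_assoc, List.take_append_of_le_length h] at hq
      rwa [List.take_append_of_le_length h]
    · rcases Nat.le_total q (P ++ y).length with h' | h'
      · obtain ⟨k, rfl⟩ := Nat.exists_eq_add_of_le h
        -- A cut inside `y` is moved back to the end of the power: the part of `y` before the cut is
        -- itself an insertion that adds no short subword.
        refine ⟨P.length, ?_⟩
        rw [List.take_append_of_le_length h', List.take_length_add_append] at hq
        have := sameSubwords_insert hn (fun a ha => hy a (List.mem_of_mem_take ha)) []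
          (y := y.take k)
        rw [List.append_nil, List.append_nil] at this
        rw [List.take_left]
        exact (hS this).2 hq
      · obtain ⟨k, rfl⟩ := Nat.exists_eq_add_of_le h'
        refine ⟨P.length + k, ?_⟩
        rw [List.take_length_add_append] at hq ⊢
        exact (hS (sameSubwords_insert hn hy _)).2 hq

/-- The words `(y z)^N (x y)^N` and `(y z)^N y (x y)^N` agree on every ranker property that is
invariant under reversal and that, for rankers with an `X`-block followed by a `Y`-block, only
depends on short scattered subwords and on `PrefixSep` for short words. -/
theorem ranker_agree {P : List A → Ranker A → Prop}
    (hrev : ∀ u r, P u.reverse (flipRanker r) ↔ P u r) {n N : ℕ} (hn : n ≤ N)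
    (hP : ∀ (α β u v : List A), α ≠ [] → α.length + β.length ≤ n → SameSubwords n u v →
      (∀ γ : List A, γ.length ≤ n → (PrefixSep α γ u ↔ PrefixSep α γ v)) →
      (P u (α.map (Prod.mk .X) ++ β.map (Prod.mk .Y)) ↔
        P v (α.map (Prod.mk .X) ++ β.map (Prod.mk .Y))))
    (x y z : List A) {r : Ranker A} (hr : r ∈ twoBlockRankers A n) :
    P (wordPow (y ++ z) N ++ wordPow (x ++ y) N) r ↔
      P (wordPow (y ++ z) N ++ y ++ wordPow (x ++ y) N) r := by
  obtain ⟨h0, hl, hb⟩ := hr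
  obtain ⟨d, α, β, hα, rfl⟩ := exists_two_blocks h0 hb
  have key : ∀ x y z : List A,
      P (wordPow (y ++ z) N ++ wordPow (x ++ y) N) (α.map (Prod.mk .X) ++ β.map (Prod.mk .Y)) ↔
      P (wordPow (y ++ z) N ++ y ++ wordPow (x ++ y) N)
        (α.map (Prod.mk .X) ++ β.map (Prod.mk .Y)) := by
    intro x y z
    have hy : ∀ a ∈ y, a ∈ y ++ z := fun a ha => List.mem_append_left _ ha
    simp only [List.length_append, List.length_map] at hl
    exact hP α β _ _ hα hl (sameSubwords_insert hn hy _)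
      fun γ hγ => prefixSep_insert_iff hn hy (by omega) hγ
  cases d with
  | X => exact key x y z
  | Y =>
    -- Reversal preserves the shape of both words: it reverses the three factors and exchanges the
    -- roles of `x` and `z`.
    rw [← hrev, ← hrev (wordPow (y ++ z) N ++ y ++ wordPow (x ++ y) N), flipRanker_two_blocks]
    simpa [wordPow_reverse, Dir.flip] using key z.reverse y.reverse x.reverse

theorem condensed_agree {n N : ℕ} (hn : n ≤ N) (x y z : List A) {r : Ranker A}
    (hr : r ∈ twoBlockRankers A n) :
    Condensed (wordPow (y ++ z) N ++ wordPow (x ++ y) N) r ↔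
      Condensed (wordPow (y ++ z) N ++ y ++ wordPow (x ++ y) N) r := by
  refine ranker_agree (fun u r => condensed_reverse_iff) hn ?_ x y z hr
  intro α β u v hα hl hS hP
  by_cases hβ : β = []
  · simpa only [hβ, List.map_nil, List.append_nil, condensed_X_iff] using hS α (by omega)
  · rw [condensed_XY_iff hα hβ, condensed_XY_iff hα hβ]
    refine and_congr (hS α (by omega)) (hP _ ?_)
    simp only [List.length_append, List.length_dropLast, List.length_reverse]
    omega

theorem defAgree_words {n N : ℕ} (hn : n ≤ N) (x y z : List A) :
    DefAgree (twoBlockRankers A n) (wordPow (y ++ z) N ++ wordPow (x ++ y) N)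
      (wordPow (y ++ z) N ++ y ++ wordPow (x ++ y) N) := by
  intro r hr
  refine ranker_agree (fun u r => rankerDefined_reverse_iff) hn ?_ x y z hr
  intro α β u v hα hl hS hP
  rw [rankerDefined_XY_iff hα, rankerDefined_XY_iff hα]
  exact and_congr (hS α (by omega)) (hP _ (by simp; omega))

/-! ### Inclusions between sets of rankers -/

theorem rankers_ne_nil {d : Dir} {m n : ℕ} {r : Ranker A} (h : r ∈ rankers A d m n) : r ≠ [] := by
  rintro rfl
  simpa using h.1

theorem rankersLE_two_subset (d : Dir) (n : ℕ) : rankersLE A d 2 n ⊆ twoBlockRankers A n := by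
  rintro r (⟨n', hn', h⟩ | ⟨m', hm', n', hn', d', h⟩)
  · exact ⟨rankers_ne_nil h, h.2.2.trans_le hn', h.2.1.le⟩
  · exact ⟨rankers_ne_nil h, h.2.2.trans_le hn'.le, h.2.1.trans_le hm'.le⟩

theorem rankersLE_length_le {d : Dir} {m n : ℕ} {r : Ranker A} (h : r ∈ rankersLE A d m n) :
    r.length ≤ n := by
  rcases h with ⟨n', hn', h⟩ | ⟨m', hm', n', hn', d', h⟩
  · exact h.2.2.trans_le hn'
  · exact h.2.2.trans_le hn'.le

/-- One level up, rankers with fewer blocks and smaller depth may start in either direction. Hence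
`R_2` and `L_2` both lie in each of `R_3` and `L_3`. -/
theorem rankersLE_subset (d d' : Dir) (m n : ℕ) :
    rankersLE A d m n ⊆ rankersLE A d' (m + 1) (n + 1) := by
  rintro r (⟨n', hn', h⟩ | ⟨m', hm', n', hn', e, h⟩)
  · exact Or.inr ⟨m, by omega, n', by omega, d, h⟩
  · exact Or.inr ⟨m', by omega, n', by omega, e, h⟩

end Words

/-! ### Pseudovarieties -/

section Pseudovarieties

theorem subset_pvGenerated (W : Set MonCat.{0}) : W ⊆ pvGenerated W :=
  fun _ hM _ hV => hV.2 hM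

theorem pvGenerated_subset {W V : Set MonCat.{0}} (hV : IsPseudovariety V) (h : W ⊆ V) :
    pvGenerated W ⊆ V :=
  Set.sInter_subset_of_mem ⟨hV, h⟩

theorem pvGenerated_subset_pvGenerated {W W' : Set MonCat.{0}} (h : W ⊆ pvGenerated W') :
    pvGenerated W ⊆ pvGenerated W' :=
  fun _ hM V hV => hM V ⟨hV.1, h.trans fun _ hN => hN V hV⟩

theorem image_mem_pvGenerated {W : Set MonCat.{0}} {M N : MonCat.{0}} (hM : M ∈ pvGenerated W)
    (f : M →* N) (hf : Function.Surjective f) : N ∈ pvGenerated W :=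
  fun V hV => hV.1.image M (hM V hV) N f hf

theorem pvJoin_subset {V W W' : Set MonCat.{0}} (hV : V ⊆ pvGenerated W')
    (hW : W ⊆ pvGenerated W') : pvJoin V W ⊆ pvGenerated W' :=
  pvGenerated_subset_pvGenerated (Set.union_subset hV hW)

theorem con_quotient_mem_of_le {P : Type} [Monoid P] {W : Set MonCat.{0}} {C D : Con P}
    (hC : MonCat.of C.Quotient ∈ pvGenerated W) (h : C ≤ D) :
    MonCat.of D.Quotient ∈ pvGenerated W := by
  refine image_mem_pvGenerated hC (Con.map C D h) ?_
  intro q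
  obtain ⟨p, rfl⟩ := Con.mk'_surjective q
  exact ⟨(p : C.Quotient), rfl⟩

/-- A finite quotient of a free monoid, all of whose congruence classes belong to `V`, lies in the
pseudovariety generated by the syntactic monoids of the languages of `V`. -/
theorem con_quotient_mem_pvOf {V : LanguageClass} {A : Type} [Finite A] (C : Con (FreeMonoid A))
    [Finite C.Quotient]
    (hC : ∀ q : C.Quotient, ({u | (FreeMonoid.ofList u : C.Quotient) = q} : Language A) ∈ V A) :
    MonCat.of C.Quotient ∈ pvOf V := by
  intro P hP
  let K : C.Quotient → Language A := fun q => {u | (FreeMonoid.ofList u : C.Quotient) = q}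
  let f : FreeMonoid A →* (∀ q, (syntacticCon (K q)).Quotient) :=
    MonoidHom.pi fun q => (syntacticCon (K q)).mk'
  have h1 : MonCat.of (∀ q, (syntacticCon (K q)).Quotient) ∈ P :=
    hP.1.prod C.Quotient (fun q => MonCat.of (syntacticCon (K q)).Quotient)
      fun q => hP.2 ⟨A, inferInstance, K q, hC q, rfl⟩
  have h2 : MonCat.of (MonoidHom.mrange f) ∈ P := hP.1.submonoid _ h1 (MonoidHom.mrange f)
  -- The component of `f` at the class of `u` already decides: with empty contexts, the syntactic
  -- congruence of that class puts `v` into it.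
  have hker : Con.ker f ≤ C := by
    intro u v huv
    have huv : f u = f v := huv
    have hq : (u : (syntacticCon (K (u : C.Quotient))).Quotient) = v :=
      congrFun huv (u : C.Quotient)
    have := ((Con.eq _).1 hq 1 1).1
    rw [one_mul, mul_one, one_mul, mul_one] at this
    exact (Con.eq C).1 (this rfl).symm
  -- The quotient by `C` is an image of the range of `f`, a submonoid of a finite product of
  -- syntactic monoids.
  refine hP.1.image _ h2 _
    ((Con.map _ _ hker).comp (Con.quotientKerEquivRange f).symm.toMonoidHom) ?_
  intro q
  obtain ⟨u, rfl⟩ := Con.mk'_surjective q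
  obtain ⟨y, hy⟩ := (Con.quotientKerEquivRange f).symm.surjective (u : (Con.ker f).Quotient)
  exact ⟨y, (congrArg (Con.map _ _ hker) hy).trans rfl⟩

theorem syntactic_mem_pvOf {V : LanguageClass} {A : Type} [Finite A] {K : Language A}
    (hK : K ∈ V A) : MonCat.of (syntacticCon K).Quotient ∈ pvOf V :=
  subset_pvGenerated _ ⟨A, inferInstance, K, hK, rfl⟩

theorem recognizes_syntactic {A : Type} (K : Language A) :
    Recognizes (MonCat.of (syntacticCon K).Quotient) K := by
  refine ⟨(syntacticCon K).mk', Set.Subset.antisymm (Set.subset_preimage_image _ _) ?_⟩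
  rintro u ⟨v, hv, hvu⟩
  have := ((Con.eq _).1 hvu 1 1).1
  rw [one_mul, mul_one, one_mul, mul_one] at this
  exact this hv

/-! ### The pseudovarieties generated by ranker congruences -/

variable {A : Type} [Finite A]

/-- A class is determined by which of the finitely many rankers are condensed on a chosen
representative. Only the inclusion of `CondAgree` in the generated congruence is needed. -/
instance finite_conGen_condAgree (d : Dir) (m n : ℕ) :
    Finite (conGen (CondAgree (A := A) d m n)).Quotient := by
  have hfin : (rankersLE A d m n).Finite :=
    (finite_rankers_length_le n).subset fun _ h => rankersLE_length_le h
  have := hfin.to_subtype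
  choose s hs using (conGen (CondAgree (A := A) d m n)).mk'_surjective
  refine Finite.of_injective
    (β := rankersLE A d m n → Prop) (fun q r => Condensed (s q).toList r) ?_
  intro q q' h
  rw [← hs q, ← hs q']
  exact (Con.eq _).2 (ConGen.Rel.of _ _ fun r hr => iff_of_eq (congrFun h ⟨r, hr⟩))

/-- Each congruence class is saturated for agreement on finitely many two-block rankers, each of
which gives an `FO²_2`-language. -/
theorem condPv_two_subset (d : Dir) : condPv d 2 ⊆ FOpv 2 := by
  refine pvGenerated_subset_pvGenerated ?_
  rintro M ⟨A, _, n, hn, rfl⟩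
  refine con_quotient_mem_pvOf (V := FOLang 2) _ fun q => ?_
  refine mem_FOLang_of_saturated (by omega)
    ((finite_twoBlockRankers (A := A) n).subset (rankersLE_two_subset d n))
    (F := fun r => {u | Condensed u r})
    (fun r hr => condensed_mem_FOLang (rankersLE_two_subset d n hr).1
      (rankersLE_two_subset d n hr).2.2) ?_
  intro u v huv hu
  refine Eq.trans ((Con.eq _).2 (ConGen.Rel.of _ _ ?_)) hu
  exact fun r hr => (huv r hr).symm

theorem condPv_succ_subset (d d' : Dir) (m : ℕ) : condPv d m ⊆ condPv d' (m + 1) := by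
  refine pvGenerated_subset_pvGenerated ?_
  rintro M ⟨A, _, n, hn, rfl⟩
  refine con_quotient_mem_of_le
    (subset_pvGenerated _ ⟨A, inferInstance, n + 1, by omega, rfl⟩) ?_
  refine Con.conGen_le.2 ?_
  exact fun u v h => ConGen.Rel.of _ _ fun r hr => h r (rankersLE_subset d d' m n hr)

/-- The finite monoids in which `(y z)^N (x y)^N = (y z)^N y (x y)^N` for all large `N`. -/
def insertionPv : Set MonCat.{0} :=
  {M | Finite M ∧ ∀ x y z : M, ∃ n, ∀ N ≥ n,
    (y * z) ^ N * (x * y) ^ N = (y * z) ^ N * y * (x * y) ^ N}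

theorem isPseudovariety_insertionPv : IsPseudovariety insertionPv where
  finite _ hM := hM.1
  prod ι _ M hM := by
    have := fun i => (hM i).1
    refine ⟨inferInstanceAs (Finite (∀ i, M i)), fun x y z => ?_⟩
    choose n hn using fun i => (hM i).2 (x i) (y i) (z i)
    -- The product is finite, so the thresholds of the factors have a common bound.
    obtain ⟨k, hk⟩ := (Set.finite_range n).bddAbove
    exact ⟨k, fun N hN => funext fun i => hn i N ((hk ⟨i, rfl⟩).trans hN)⟩
  image M hM N f hf := by
    have := hM.1
    refine ⟨Finite.of_surjective f hf, fun x y z => ?_⟩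
    obtain ⟨x, rfl⟩ := hf x
    obtain ⟨y, rfl⟩ := hf y
    obtain ⟨z, rfl⟩ := hf z
    obtain ⟨n, hn⟩ := hM.2 x y z
    exact ⟨n, fun N hN => by simpa using congrArg f (hn N hN)⟩
  submonoid M hM S := by
    have := hM.1
    refine ⟨inferInstanceAs (Finite S), fun x y z => ?_⟩
    obtain ⟨n, hn⟩ := hM.2 x.1 y.1 z.1
    exact ⟨n, fun N hN => Subtype.ext (hn N hN)⟩

theorem condPv_two_subset_insertionPv (d : Dir) : condPv d 2 ⊆ insertionPv := by
  refine pvGenerated_subset isPseudovariety_insertionPv ?_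
  rintro M ⟨A, _, n, hn, rfl⟩
  refine ⟨finite_conGen_condAgree d 2 n, fun x y z => ⟨n, fun N hN => ?_⟩⟩
  obtain ⟨x, rfl⟩ := (conGen (CondAgree (A := A) d 2 n)).mk'_surjective x
  obtain ⟨y, rfl⟩ := (conGen (CondAgree (A := A) d 2 n)).mk'_surjective y
  obtain ⟨z, rfl⟩ := (conGen (CondAgree (A := A) d 2 n)).mk'_surjective z
  refine (Con.eq _).2 (ConGen.Rel.of ((y * z) ^ N * (x * y) ^ N)
    ((y * z) ^ N * y * (x * y) ^ N) fun r hr => ?_)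
  simpa only [FreeMonoid.toList_mul, toList_pow] using
    condensed_agree hN x.toList y.toList z.toList (rankersLE_two_subset d n hr)

theorem pvJoin_subset_insertionPv : pvJoin (Rpv 2) (Lpv 2) ⊆ insertionPv :=
  pvGenerated_subset isPseudovariety_insertionPv
    (Set.union_subset (condPv_two_subset_insertionPv _) (condPv_two_subset_insertionPv _))

end Pseudovarieties

/-! ### An automaton for the example language -/

section Example

/-- The transitions of a deterministic automaton for `{b,c}* c a {a,b}*`, with initial state `0`,
accepting state `2` and sink `3`. -/
def exStep : Fin 4 → ABC → Fin 4
  | 0, .a => 3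
  | 0, .b => 0
  | 0, .c => 1
  | 1, .a => 2
  | 1, .b => 0
  | 1, .c => 1
  | 2, .a => 2
  | 2, .b => 2
  | 2, .c => 3
  | 3, _ => 3

/-- The state reached from `q` by reading the word `u`. -/
def exRun (q : Fin 4) (u : List ABC) : Fin 4 := u.foldl exStep q

theorem exRun_append (q : Fin 4) (u v : List ABC) : exRun q (u ++ v) = exRun (exRun q u) v :=
  List.foldl_append

theorem exRun_cons (q : Fin 4) (s : ABC) (u : List ABC) :
    exRun q (s :: u) = exRun (exStep q s) u := rfl

theorem mem_kstar_pair_iff {s t : ABC} {u : List ABC} :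
    u ∈ ({[s], [t]} : Language ABC)∗ ↔ ∀ l ∈ u, l = s ∨ l = t := by
  rw [Language.mem_kstar]
  constructor
  · rintro ⟨L, rfl, hL⟩ l hl
    obtain ⟨w, hw, hlw⟩ := List.mem_flatten.1 hl
    rcases hL w hw with rfl | rfl
    · exact Or.inl (List.mem_singleton.1 hlw)
    · exact Or.inr (List.mem_singleton.1 hlw)
  · intro h
    refine ⟨u.map fun l => [l], by simp [List.flatten_eq_flatMap, List.flatMap_map], fun w hw => ?_⟩
    obtain ⟨l, hl, rfl⟩ := List.mem_map.1 hw
    rcases h l hl with rfl | rfl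
    · exact Or.inl rfl
    · exact Or.inr rfl

theorem mem_exLang_iff {u : List ABC} :
    u ∈ exLang ↔ ∃ s t : List ABC, ABC.a ∉ s ∧ ABC.c ∉ t ∧ u = s ++ .c :: .a :: t := by
  have ha : ∀ s : List ABC, (∀ l ∈ s, l = ABC.b ∨ l = ABC.c) ↔ ABC.a ∉ s := by
    refine fun s => ⟨fun h h' => by simpa using h _ h', fun h l hl => ?_⟩
    cases l <;> simp_all
  have hc : ∀ s : List ABC, (∀ l ∈ s, l = ABC.a ∨ l = ABC.b) ↔ ABC.c ∉ s := by
    refine fun s => ⟨fun h h' => by simpa using h _ h', fun h l hl => ?_⟩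
    cases l <;> simp_all
  simp only [exLang, Language.mem_mul, mem_kstar_pair_iff, ha, hc]
  constructor
  · rintro ⟨w, ⟨s, hs, m, hm, rfl⟩, t, ht, rfl⟩
    obtain rfl : m = [.c, .a] := hm
    exact ⟨s, t, hs, ht, by simp⟩
  · rintro ⟨s, t, hs, ht, rfl⟩
    exact ⟨s ++ [.c, .a], ⟨s, hs, [.c, .a], rfl, rfl⟩, t, ht, by simp⟩

/-- The letters `b` and `c` preserve the sets of states `{0, 1}` and `{2, 3}`, and `c` is constant
on each of them. -/
theorem exRun_of_no_a {s : List ABC} (hs : ABC.a ∉ s) (q : Fin 4) :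
    exRun q (s ++ [.c]) = exRun q [.c] := by
  induction s generalizing q with
  | nil => rfl
  | cons l s ih =>
    rw [List.cons_append, exRun_cons, ih fun h => hs (List.mem_cons_of_mem _ h)]
    have : l ≠ .a := fun h => hs (h ▸ List.mem_cons_self)
    clear ih hs
    revert q
    cases l <;> first | exact absurd rfl this | decide

/-- Reading `a` leads to state `2` or `3`, and both are fixed by `a` and `b`. -/
theorem exRun_of_no_c {t : List ABC} (ht : ABC.c ∉ t) (q : Fin 4) :
    exRun q (.a :: t) = exRun q [.a] := by
  induction t using List.reverseRecOn with
  | nil => rfl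
  | append_singleton t l ih =>
    rw [← List.cons_append, exRun_append, ih fun h => ht (List.mem_append_left _ h)]
    have : l ≠ .c := fun h => ht (by simp [h])
    clear ih ht
    revert q
    cases l <;> first | exact absurd rfl this | decide

/-- The letter `b` acts as an idempotent. -/
theorem exRun_of_only_b {m : List ABC} (ha : ABC.a ∉ m) (hc : ABC.c ∉ m) (q : Fin 4) :
    exRun q m = if ABC.b ∈ m then exRun q [.b] else q := by
  induction m generalizing q with
  | nil => rfl
  | cons l m ih =>
    obtain rfl : l = .b := by cases l <;> simp_all
    rw [exRun_cons, ih (fun h => ha (by simp [h])) (fun h => hc (by simp [h]))]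
    clear ih ha hc
    simp only [List.mem_cons, true_or, if_true]
    split_ifs <;> revert q <;> decide

theorem exRun_sink (u : List ABC) : exRun 3 u = 3 := by
  induction u with
  | nil => rfl
  | cons l u ih => exact ih

theorem mem_exLang_iff_exRun {u : List ABC} : u ∈ exLang ↔ exRun 0 u = 2 := by
  rw [mem_exLang_iff]
  constructor
  · rintro ⟨s, t, hs, ht, rfl⟩
    rw [← List.singleton_append, ← List.append_assoc, exRun_append, exRun_of_no_a hs,
      exRun_of_no_c ht]
    rfl
  -- The induction needs a description of the words leading to each state other than the sink, not
  -- only to the accepting one.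
  · have key : ∀ u : List ABC, (exRun 0 u = 0 → ABC.a ∉ u) ∧
        (exRun 0 u = 1 → ∃ s, ABC.a ∉ s ∧ u = s ++ [.c]) ∧
        (exRun 0 u = 2 → ∃ s t, ABC.a ∉ s ∧ ABC.c ∉ t ∧ u = s ++ ABC.c :: .a :: t) := by
      intro u
      induction u using List.reverseRecOn with
      | nil => exact ⟨fun _ => by simp, fun h => by simp [exRun] at h, fun h => by simp [exRun] at h⟩
      | append_singleton u l ih =>
        obtain ⟨h0, h1, h2⟩ := ih
        have hstep : exRun 0 (u ++ [l]) = exStep (exRun 0 u) l := exRun_append 0 u [l]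
        rw [hstep]
        generalize exRun 0 u = q at h0 h1 h2
        have hq : ∀ q : Fin 4, q = 0 ∨ q = 1 ∨ q = 2 ∨ q = 3 := by decide
        rcases hq q with rfl | rfl | rfl | rfl
        · have hu := h0 rfl
          cases l
          · simp [exStep]
          · simpa [exStep] using hu
          · exact ⟨by simp [exStep], fun _ => ⟨u, hu, rfl⟩, by simp [exStep]⟩
        · obtain ⟨s, hs, rfl⟩ := h1 rfl
          cases l
          · exact ⟨by simp [exStep], by simp [exStep], fun _ => ⟨s, [], hs, by simp, by simp⟩⟩
          · simpa [exStep] using hs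
          · exact ⟨by simp [exStep], fun _ => ⟨s ++ [.c], by simpa using hs, rfl⟩,
              by simp [exStep]⟩
        · obtain ⟨s, t, hs, ht, rfl⟩ := h2 rfl
          cases l
          · exact ⟨by simp [exStep], by simp [exStep],
              fun _ => ⟨s, t ++ [.a], hs, by simpa using ht, by simp⟩⟩
          · exact ⟨by simp [exStep], by simp [exStep],
              fun _ => ⟨s, t ++ [.b], hs, by simpa using ht, by simp⟩⟩
          · simp [exStep]
        · simp [exStep]
    exact (key u).2.2

theorem syntacticCon_of_exRun {u v : FreeMonoid ABC}
    (h : ∀ q, exRun q u.toList = exRun q v.toList) : syntacticCon exLang u v := by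
  intro x y
  simp only [mem_exLang_iff_exRun, FreeMonoid.toList_mul, exRun_append, h]

theorem exRun_wordPow {q : Fin 4} {w : List ABC} (h : exRun q w = q) (N : ℕ) :
    exRun q (wordPow w N) = q := by
  induction N with
  | zero => rfl
  | succ N ih => rw [wordPow_succ, exRun_append, h, ih]

/-- After `(bc)^(N+1)` the automaton is in state `1`, from which `a` leads to acceptance. An extra
`b` brings it back to state `0`, from which `a` leads to the sink. -/
theorem words_separated (N : ℕ) :
    wordPow [ABC.b, .c] (N + 1) ++ wordPow [ABC.a, .b] (N + 1) ∈ exLang ∧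
      wordPow [ABC.b, .c] (N + 1) ++ [.b] ++ wordPow [ABC.a, .b] (N + 1) ∉ exLang := by
  have h1 : exRun 0 (wordPow [ABC.b, .c] (N + 1)) = 1 := by
    rw [wordPow_succ, exRun_append]
    exact exRun_wordPow (by decide) N
  rw [mem_exLang_iff_exRun, mem_exLang_iff_exRun, exRun_append, exRun_append, exRun_append, h1]
  refine ⟨?_, ?_⟩
  · rw [wordPow_succ, exRun_append]
    exact exRun_wordPow (q := 2) (by decide) N
  · rw [wordPow_succ, exRun_append]
    change exRun 3 _ ≠ 2
    rw [exRun_sink]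
    decide

theorem not_recognizes_exLang {M : MonCat.{0}} (hM : M ∈ pvJoin (Rpv 2) (Lpv 2)) :
    ¬ Recognizes M exLang := by
  rintro ⟨h, hh⟩
  -- The identity is used at the images of `a`, `b`, `c`; it forces the image of a word outside the
  -- language to equal that of a word inside.
  obtain ⟨n, hn⟩ := (pvJoin_subset_insertionPv hM).2 (h (.of .a)) (h (.of .b)) (h (.of .c))
  have key := hn (n + 1) (by omega)
  simp only [← map_mul, ← map_pow] at key
  obtain ⟨h1, h2⟩ := words_separated n
  refine h2 ?_
  have hw : ∀ w : FreeMonoid ABC, w.toList ∈ exLang ↔ w.toList ∈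
      (fun u => h (FreeMonoid.ofList u)) ⁻¹' ((fun u => h (FreeMonoid.ofList u)) '' exLang) :=
    fun w => iff_of_eq (congrArg (w.toList ∈ ·) hh)
  have hU := toList_pow (FreeMonoid.of ABC.b * FreeMonoid.of ABC.c) (n + 1)
  have hV := toList_pow (FreeMonoid.of ABC.a * FreeMonoid.of ABC.b) (n + 1)
  have := (hw ((.of .b * .of .c) ^ (n + 1) * .of .b * (.of .a * .of .b) ^ (n + 1))).2
    ⟨_, h1, ?_⟩
  · rw [FreeMonoid.toList_mul, FreeMonoid.toList_mul, hU, hV] at this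
    exact this
  · refine Eq.trans (congrArg h ?_) key
    apply FreeMonoid.toList.injective
    rw [FreeMonoid.toList_mul, hU, hV]
    rfl

theorem exLang_not_mem_TLLang : exLang ∉ TLLang 2 ABC := by
  intro h
  obtain ⟨n, hn⟩ := exists_defAgree_of_mem_TLLang h
  obtain ⟨h1, h2⟩ := words_separated n
  exact h2 ((hn _ _ (defAgree_words (Nat.le_succ n) [ABC.a] [.b] [.c])).1 h1)

/-! ### The sentence of the example -/

theorem exSentence_mem : exSentence ∈ FOfrag ABC 2 := by
  rw [mem_FOfrag_iff]
  decide

theorem letterAt_append_iff {A : Type} {s t : List A} {p : ℕ} {a : A} :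
    LetterAt (s ++ t) p a ↔ LetterAt s p a ∨ (s.length < p ∧ LetterAt t (p - s.length) a) := by
  unfold LetterAt
  rcases Nat.lt_or_ge (p - 1) s.length with h | h
  · rw [List.getElem?_append_left h]
    constructor
    · exact Or.inl
    · rintro (h | h)
      · exact h
      · omega
  · rw [List.getElem?_append_right h, List.getElem?_eq_none h,
      show p - 1 - s.length = p - s.length - 1 by omega]
    constructor
    · rintro ⟨h1, h2⟩
      rcases Nat.lt_or_ge s.length p with h' | h'
      · exact Or.inr ⟨h', by omega, h2⟩
      · obtain rfl : s = [] := List.length_eq_zero_iff.1 (by omega)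
        exact Or.inr ⟨by simp; omega, by simp; omega, h2⟩
    · rintro (⟨-, h2⟩ | ⟨h1, h2, h3⟩)
      · simp at h2
      · exact ⟨by omega, h3⟩

theorem letterAt_cons_iff {A : Type} {t : List A} {p : ℕ} {a b : A} :
    LetterAt (b :: t) p a ↔ (p = 1 ∧ a = b) ∨ (1 < p ∧ LetterAt t (p - 1) a) := by
  rw [← List.singleton_append, letterAt_append_iff, List.length_singleton]
  refine or_congr_left ?_
  constructor
  · intro h
    have h1 := letterAt_le_length h
    have h2 := h.1
    simp only [List.length_singleton] at h1
    obtain rfl : p = 1 := by omega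
    have := h.2
    simp at this
    exact ⟨rfl, this.symm⟩
  · rintro ⟨rfl, rfl⟩
    exact ⟨le_rfl, rfl⟩

theorem LetterAt.mem {A : Type} {u : List A} {p : ℕ} {a : A} (h : LetterAt u p a) : a ∈ u :=
  List.mem_of_getElem? h.2

theorem exists_letterAt_of_mem {A : Type} {u : List A} {a : A} (h : a ∈ u) :
    ∃ p, LetterAt u p a := by
  obtain ⟨i, hi⟩ := List.mem_iff_getElem?.1 h
  exact ⟨i + 1, by omega, by simpa using hi⟩

theorem LetterAt.unique {A : Type} {u : List A} {p : ℕ} {a b : A} (h : LetterAt u p a)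
    (h' : LetterAt u p b) : a = b :=
  Option.some.inj (h.2.symm.trans h'.2)

theorem exists_letterAt {A : Type} {u : List A} {p : ℕ} (h1 : 1 ≤ p) (h2 : p ≤ u.length) :
    ∃ a, LetterAt u p a :=
  ⟨u[p - 1], h1, List.getElem?_eq_getElem _⟩

theorem sat_noneBefore (u : List ABC) (s : ABC) (v : Fin 2 → ℕ) :
    (noneBefore s).Sat u v ↔ ∀ q, LetterAt u q s → v 0 ≤ q := by
  have h01 : (0 : Fin 2) ≠ 1 := by decide
  simp only [noneBefore, Formula.Sat, Function.update_self, Function.update_of_ne h01]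
  constructor
  · intro h q hq
    rcases h q hq.1 (letterAt_le_length hq) with h | h
    · omega
    · exact absurd hq h
  · intro h q _ _
    by_cases hq : LetterAt u q s
    · have := h q hq
      exact Or.inl (by omega)
    · exact Or.inr hq

theorem sat_noneAfter (u : List ABC) (s : ABC) (v : Fin 2 → ℕ) :
    (noneAfter s).Sat u v ↔ ∀ q, LetterAt u q s → q ≤ v 0 := by
  have h01 : (0 : Fin 2) ≠ 1 := by decide
  simp only [noneAfter, Formula.Sat, Function.update_self, Function.update_of_ne h01]
  constructor
  · intro h q hq
    rcases h q hq.1 (letterAt_le_length hq) with h | h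
    · omega
    · exact absurd hq h
  · intro h q _ _
    by_cases hq : LetterAt u q s
    · have := h q hq
      exact Or.inl (by omega)
    · exact Or.inr hq

theorem exSentence_sat_iff (u : List ABC) : exSentence.Sat u (fun _ => 0) ↔
    (∃ p, LetterAt u p .c ∧ (∀ q, LetterAt u q .a → p ≤ q) ∧ ∀ q, LetterAt u q .c → q ≤ p) ∧
    (∃ p, LetterAt u p .a ∧ (∀ q, LetterAt u q .a → p ≤ q) ∧ ∀ q, LetterAt u q .c → q ≤ p) ∧
    (∀ p, LetterAt u p .b → (∃ q < p, LetterAt u q .a) ∨ ∃ q, p < q ∧ LetterAt u q .c) := by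
  have hpos : ∀ {s q}, LetterAt u q s → 1 ≤ q ∧ q ≤ u.length := fun h =>
    ⟨h.1, letterAt_le_length h⟩
  have h01 : (0 : Fin 2) ≠ 1 := by decide
  simp only [exSentence, Formula.Sat, sat_noneBefore, sat_noneAfter, Function.update_self,
    Function.update_of_ne h01]
  refine and_congr ?_ (and_congr ?_ ?_)
  · exact ⟨fun ⟨p, _, _, h⟩ => ⟨p, h⟩, fun ⟨p, h⟩ => ⟨p, (hpos h.1).1, (hpos h.1).2, h⟩⟩
  · exact ⟨fun ⟨p, _, _, h⟩ => ⟨p, h⟩, fun ⟨p, h⟩ => ⟨p, (hpos h.1).1, (hpos h.1).2, h⟩⟩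
  · constructor
    · intro h p hp
      rcases h p (hpos hp).1 (hpos hp).2 with h' | ⟨q, -, -, h1, h2⟩ | ⟨q, -, -, h1, h2⟩
      · exact absurd hp h'
      · exact Or.inl ⟨q, h1, h2⟩
      · exact Or.inr ⟨q, h1, h2⟩
    · intro h p h1 h2
      by_cases hp : LetterAt u p .b
      · rcases h p hp with ⟨q, hq, hqa⟩ | ⟨q, hq, hqa⟩
        · exact Or.inr (Or.inl ⟨q, (hpos hqa).1, (hpos hqa).2, hq, hqa⟩)
        · exact Or.inr (Or.inr ⟨q, (hpos hqa).1, (hpos hqa).2, hq, hqa⟩)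
      · exact Or.inl hp

theorem exSentence_defines : exSentence.Defines exLang := by
  refine ⟨by decide, fun u => ?_⟩
  rw [exSentence_sat_iff, mem_exLang_iff]
  constructor
  · rintro ⟨s, t, hs, ht, rfl⟩
    have hsa : ∀ p, ¬ LetterAt s p .a := fun p hp => hs hp.mem
    have htc : ∀ p, ¬ LetterAt t p .c := fun p hp => ht hp.mem
    simp only [letterAt_append_iff, letterAt_cons_iff, hsa, htc, false_or, reduceCtorEq, and_false,
      or_false, and_true]
    refine ⟨⟨s.length + 1, by omega, by omega, ?_⟩, ⟨s.length + 2, by omega, by omega, ?_⟩, ?_⟩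
    · rintro q (hq | hq)
      · have := letterAt_le_length hq
        omega
      · omega
    · rintro q (hq | hq)
      · have := letterAt_le_length hq
        omega
      · omega
    · rintro p (hp | hp)
      · have := letterAt_le_length hp
        exact Or.inr ⟨s.length + 1, by omega, by omega⟩
      · exact Or.inl ⟨s.length + 2, by omega, by omega⟩
  · rintro ⟨⟨p, hp, hpa, hpc⟩, ⟨q, hq, hqa, hqc⟩, hb⟩
    have h1 := hqc p hp
    have h2 : p ≠ q := by
      rintro rfl
      simpa using hp.unique hq
    have hql := letterAt_le_length hq
    have h3 : q = p + 1 := by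
      -- Otherwise position `p + 1` lies strictly between the last `c` and the first `a`. It can
      -- carry neither of these letters, and a `b` there violates the third conjunct.
      by_contra h3
      obtain ⟨l, hl⟩ := exists_letterAt (u := u) (p := p + 1) (by omega) (by omega)
      cases l with
      | a => have := hqa _ hl; omega
      | b =>
        rcases hb _ hl with ⟨r, hr, hra⟩ | ⟨r, hr, hrc⟩
        · have := hqa _ hra; omega
        · have := hpc _ hrc; omega
      | c => have := hpc _ hl; omega
    subst h3
    have hp1 := hp.1
    refine ⟨u.take (p - 1), u.drop (p + 1), fun h => ?_, fun h => ?_, ?_⟩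
    · obtain ⟨i, hi, hia⟩ := List.mem_take_iff_getElem.1 h
      have := hqa (i + 1) ⟨by omega, by simp [← hia]⟩
      omega
    · obtain ⟨i, hi⟩ := List.mem_iff_getElem?.1 h
      rw [List.getElem?_drop] at hi
      have := hpc (p + 1 + i + 1) ⟨by omega, by simpa using hi⟩
      omega
    · have e1 : u.drop (p - 1) = .c :: u.drop p := by
        obtain ⟨h, h'⟩ := List.getElem?_eq_some_iff.1 hp.2
        rw [List.drop_eq_getElem_cons h, h', show p - 1 + 1 = p by omega]
      have e2 : u.drop p = .a :: u.drop (p + 1) := by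
        obtain ⟨h, h'⟩ := List.getElem?_eq_some_iff.1 hq.2
        have hh : u[p] = ABC.a := h'
        rw [List.drop_eq_getElem_cons (show p < u.length by omega), hh]
      rw [← e2, ← e1, List.take_append_drop]

end Example

/-! ### Three-block rankers determine the syntactic class of a word -/

section ThreeBlocks

variable {A : Type} {s m t : List A} {x y b : A}

theorem exists_isNext_X_lt_iff {u : List A} {i j : ℕ} :
    (∃ r, IsNext u .X b i r ∧ r < j) ↔ ∃ r, i < r ∧ r < j ∧ LetterAt u r b := by
  constructor
  · rintro ⟨r, hr, hrj⟩
    exact ⟨r, hr.2.1, hrj, hr.1⟩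
  · rintro ⟨r, hi, hj, hr⟩
    obtain ⟨q, hq, hqr⟩ := exists_isNext_X hr hi
    exact ⟨q, hq, by omega⟩

theorem exists_isNext_Y_gt_iff {u : List A} {i j : ℕ} :
    (∃ r, IsNext u .Y b j r ∧ i < r) ↔ ∃ r, i < r ∧ r < j ∧ LetterAt u r b := by
  constructor
  · rintro ⟨r, hr, hri⟩
    exact ⟨r, hri, hr.2.1, hr.1⟩
  · rintro ⟨r, hi, hj, hr⟩
    obtain ⟨q, hq, hqr⟩ := exists_isNext_Y hr hj
    exact ⟨q, hq, by omega⟩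

theorem letterAt_length_succ : LetterAt (s ++ x :: t) (s.length + 1) x :=
  ⟨by omega, by simp⟩

theorem isNext_X_first (hs : x ∉ s) : IsNext (s ++ x :: t) .X x 0 (s.length + 1) := by
  refine ⟨letterAt_length_succ, by omega, fun q _ hq h => ?_⟩
  rcases letterAt_append_iff.1 h with h | ⟨h, -⟩
  · exact hs h.mem
  · omega

theorem isNext_Y_after (hm : y ∉ m) :
    IsNext (s ++ y :: (m ++ t)) .Y y (s.length + 1 + m.length + 1) (s.length + 1) := by
  refine ⟨letterAt_length_succ, by omega, fun q hq hq' h => ?_⟩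
  rcases letterAt_append_iff.1 h with h | ⟨-, h⟩
  · have := letterAt_le_length h
    omega
  · rcases letterAt_cons_iff.1 h with ⟨h, -⟩ | ⟨-, h⟩
    · omega
    · rcases letterAt_append_iff.1 h with h | ⟨h, -⟩
      · exact hm h.mem
      · omega

theorem exists_letterAt_between_iff :
    (∃ r, s.length < r ∧ r < s.length + m.length + 1 ∧ LetterAt (s ++ (m ++ t)) r b) ↔ b ∈ m := by
  constructor
  · rintro ⟨r, h1, h2, h⟩
    rcases letterAt_append_iff.1 h with h | ⟨-, h⟩
    · have := letterAt_le_length h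
      omega
    · rcases letterAt_append_iff.1 h with h | ⟨h, -⟩
      · exact h.mem
      · omega
  · intro h
    obtain ⟨r, hr⟩ := exists_letterAt_of_mem h
    have h1 := hr.1
    have h2 := letterAt_le_length hr
    refine ⟨s.length + r, by omega, by omega, letterAt_append_iff.2 (Or.inr ⟨by omega, ?_⟩)⟩
    rw [Nat.add_sub_cancel_left]
    exact letterAt_append_iff.2 (Or.inl hr)

theorem condensed_XY_pair_iff (hs : x ∉ s) :
    Condensed (s ++ x :: t) [(.X, x), (.Y, b)] ↔ b ∈ s := by
  have hp := isNext_X_first (t := t) hs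
  have key : Condensed (s ++ x :: t) [(.X, x), (.Y, b)] ↔
      ∃ q, IsNext (s ++ x :: t) .Y b (s.length + 1) q ∧ 0 < q := by
    constructor
    · rintro ⟨p, hp', -, h⟩
      obtain rfl := hp.unique hp'
      exact h
    · intro h
      exact ⟨_, hp, by simp, h⟩
  rw [key, exists_isNext_Y_gt_iff]
  simpa using exists_letterAt_between_iff (s := []) (m := s) (t := x :: t) (b := b)

theorem condensed_YX_pair_iff (ht : x ∉ t) :
    Condensed (s ++ x :: t) [(.Y, x), (.X, b)] ↔ b ∈ t := by
  rw [← condensed_reverse_iff]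
  simpa [flipRanker, Dir.flip] using
    condensed_XY_pair_iff (s := t.reverse) (t := s.reverse) (x := x) (b := b) (by simpa using ht)

/-- The first `x` fixes the right end and the last `y` before it the left end, so the final move
searches exactly the factor `m`. -/
theorem condensed_XYX_iff (hs : x ∉ s) (hm : x ∉ m) (hym : y ∉ m) (hxy : x ≠ y) :
    Condensed (s ++ y :: (m ++ x :: t)) [(.X, x), (.Y, y), (.X, b)] ↔ b ∈ m := by
  have hp : IsNext (s ++ y :: (m ++ x :: t)) .X x 0 (s.length + 1 + m.length + 1) := by
    have := isNext_X_first (s := s ++ y :: m) (t := t) (x := x) (by simp [hs, hm, hxy])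
    convert this using 1
    · simp
    · simp; omega
  have hq := isNext_Y_after (s := s) (t := x :: t) hym
  have key : Condensed (s ++ y :: (m ++ x :: t)) [(.X, x), (.Y, y), (.X, b)] ↔
      ∃ r, IsNext (s ++ y :: (m ++ x :: t)) .X b (s.length + 1) r ∧
        r < s.length + 1 + m.length + 1 := by
    constructor
    · rintro ⟨p, hp', -, q, hq', -, h⟩
      obtain rfl := hp.unique hp'
      obtain rfl := hq.unique hq'
      exact h
    · intro h
      exact ⟨_, hp, by simp; omega, _, hq, by omega, h⟩
  rw [key, exists_isNext_X_lt_iff]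
  simpa using exists_letterAt_between_iff (s := s ++ [y]) (m := m) (t := x :: t) (b := b)

theorem condensed_YXY_iff (ht : y ∉ t) (hm : x ∉ m) (hym : y ∉ m) (hxy : x ≠ y) :
    Condensed (s ++ y :: (m ++ x :: t)) [(.Y, y), (.X, x), (.Y, b)] ↔ b ∈ m := by
  rw [← condensed_reverse_iff]
  simpa [flipRanker, Dir.flip] using
    condensed_XYX_iff (s := t.reverse) (t := s.reverse) (m := m.reverse) (x := y) (y := x) (b := b)
      (by simpa using ht) (by simpa using hym) (by simpa using hm) hxy.symm

theorem condensed_singleton_iff {u : List A} : Condensed u [(.X, x)] ↔ x ∈ u :=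
  (condensed_X_iff (α := [x])).trans List.singleton_sublist

theorem exists_last_split (h : x ∈ s) : ∃ s₁ s₂, s = s₁ ++ x :: s₂ ∧ x ∉ s₂ := by
  obtain ⟨l₁, l₂, h1, h2⟩ := List.eq_append_cons_of_mem (List.mem_reverse.2 h)
  exact ⟨l₂.reverse, l₁.reverse, by rw [← s.reverse_reverse, h1]; simp, by simpa using h2⟩

end ThreeBlocks

/-! ### Membership of the syntactic monoid in `R_3` and `L_3` -/

section Canonical

open Classical in
/-- A short word on which the automaton acts as on any word with the following properties:
`α`, `β`, `γ` state that the letters `a`, `b`, `c` occur, `αγ` that some `a` precedes some `c`,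
`βα` that some `b` precedes the first `a`, `γβ` that some `b` follows the last `c`, and `γβα` that
there is a `b` between the last `c` and the first `a`. -/
noncomputable def shortWord (α β γ αγ βα γβ γβα : Prop) : List ABC :=
  if α then
    if γ then if αγ ∨ γβα then [.a, .c] else [.c, .a]
    else if βα then [.b, .a] else [.a]
  else if γ then if γβ then [.c, .b] else [.c]
  else if β then [.b] else []

/-- The short word on which the automaton acts as on `u`, chosen by means of rankers; `r` is a
three-block ranker that detects a `b` between the last `c` and the first `a`. -/
noncomputable def canonicalWord (r : Ranker ABC) (u : List ABC) : List ABC :=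
  shortWord (Condensed u [(.X, .a)]) (Condensed u [(.X, .b)]) (Condensed u [(.X, .c)])
    (Condensed u [(.X, .a), (.X, .c)]) (Condensed u [(.X, .a), (.Y, .b)])
    (Condensed u [(.Y, .c), (.X, .b)]) (Condensed u r)

theorem exRun_of_a_before_c {u : List ABC} (h : [ABC.a, .c].Sublist u) (q : Fin 4) :
    exRun q u = 3 := by
  obtain ⟨s, t, rfl, hs, ht⟩ := List.cons_sublist_iff.1 h
  obtain ⟨s, s', rfl⟩ := List.append_of_mem hs
  obtain ⟨m, m', rfl, hm⟩ := List.eq_append_cons_of_mem (List.singleton_sublist.1 ht)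
  -- The `c` is replaced by the first one after the chosen `a`: the factor from that `a` up to it is
  -- `c`-free, so it leads to `2` or `3`, and then `c` leads to the sink.
  obtain ⟨k, k', hk, hck⟩ := List.eq_append_cons_of_mem
    (show ABC.c ∈ s' ++ m ++ [.c] by simp)
  have e : s ++ .a :: s' ++ (m ++ .c :: m') = s ++ (.a :: k ++ (.c :: (k' ++ m'))) := by
    have : s' ++ (m ++ .c :: m') = k ++ .c :: (k' ++ m') := by
      simpa using congrArg (· ++ m') hk
    simp [this]
  rw [e, exRun_append, exRun_append, exRun_of_no_c hck, exRun_cons]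
  generalize exRun q s = q'
  have : exStep (exRun q' [.a]) .c = 3 := by revert q'; decide
  rw [this, exRun_sink]

/-- If all `c` precede all `a` and both occur, then `u = s c m a t` with `c` last and `a` first. The
factors `s` and `t` are absorbed by `c` and `a`, and only the presence of `b` in `m` matters. The
other cases are similar, with shorter rankers detecting `b`. -/
theorem exRun_canonicalWord {r : Ranker ABC}
    (hr : ∀ s m t : List ABC, ABC.a ∉ s → ABC.a ∉ m → ABC.c ∉ m → ABC.c ∉ t →
      (Condensed (s ++ .c :: (m ++ .a :: t)) r ↔ ABC.b ∈ m)) (u : List ABC) (q : Fin 4) :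
    exRun q u = exRun q (canonicalWord r u) := by
  have hac : Condensed u [(.X, .a), (.X, .c)] ↔ [ABC.a, .c].Sublist u :=
    condensed_X_iff (α := [ABC.a, .c])
  unfold canonicalWord
  simp only [condensed_singleton_iff, hac]
  unfold shortWord
  by_cases ha : ABC.a ∈ u
  · obtain ⟨s, t, rfl, hs⟩ := List.eq_append_cons_of_mem ha
    rw [if_pos ha]
    by_cases hc : ABC.c ∈ s ++ .a :: t
    · rw [if_pos hc]
      by_cases hact : [ABC.a, .c].Sublist (s ++ .a :: t)
      · rw [if_pos (Or.inl hact), exRun_of_a_before_c hact,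
          exRun_of_a_before_c (List.Sublist.refl _)]
      · have ht : ABC.c ∉ t := fun ht => hact (((List.singleton_sublist.2 ht).cons_cons _).trans
          (List.sublist_append_right _ _))
        have hcs : ABC.c ∈ s := by simpa [ht] using hc
        obtain ⟨s, m, rfl, hm⟩ := exists_last_split hcs
        have has : ABC.a ∉ s := fun h => hs (by simp [h])
        have ham : ABC.a ∉ m := fun h => hs (by simp [h])
        have hrun : exRun q (s ++ .c :: m ++ .a :: t) =
            exRun (exRun (exRun q [.c]) m) [.a] := by
          rw [exRun_append, exRun_of_no_c ht, ← List.singleton_append, ← List.append_assoc,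
            exRun_append, exRun_of_no_a has]
        rw [hrun, exRun_of_only_b ham hm]
        rw [List.append_assoc, List.cons_append] at hact ⊢
        have := hr s m t has ham hm ht
        by_cases hb : ABC.b ∈ m
        -- Both `cba` and `ac` send every state to the sink.
        · rw [if_pos hb, if_pos (Or.inr (this.2 hb))]
          clear * -
          revert q
          decide
        · rw [if_neg hb, if_neg (not_or.2 ⟨hact, mt this.1 hb⟩)]
          rfl
    · rw [if_neg hc]
      have ht : ABC.c ∉ t := fun h => hc (by simp [h])
      have hcs : ABC.c ∉ s := fun h => hc (by simp [h])
      rw [exRun_append, exRun_of_no_c ht, exRun_of_only_b hs hcs]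
      simp only [condensed_XY_pair_iff hs]
      split_ifs <;> rfl
  · rw [if_neg ha]
    by_cases hc : ABC.c ∈ u
    · obtain ⟨s, t, rfl, ht⟩ := exists_last_split hc
      have has : ABC.a ∉ s := fun h => ha (by simp [h])
      have hat : ABC.a ∉ t := fun h => ha (by simp [h])
      rw [if_pos hc, ← List.singleton_append, ← List.append_assoc, exRun_append,
        exRun_of_no_a has, exRun_of_only_b hat ht]
      simp only [List.append_assoc, List.singleton_append, condensed_YX_pair_iff ht]
      split_ifs <;> rfl
    · rw [if_neg hc, exRun_of_only_b ha hc]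
      split_ifs <;> rfl

/-- A ranker has at most as many blocks as letters, so those of depth at most two are available
whatever the prescribed first direction. -/
theorem mem_rankersLE_three {d d' : Dir} {r : Ranker ABC} (h0 : (r.map Prod.fst).head? = some d')
    (h2 : r.length ≤ 2) : r ∈ rankersLE ABC d 3 3 := by
  refine Or.inr ⟨_, ?_, _, Nat.lt_succ_of_le h2, d', h0, rfl, rfl⟩
  have := (List.destutter_sublist (· ≠ ·) (r.map Prod.fst)).length_le
  rw [List.length_map] at this
  exact Nat.lt_succ_of_le (this.trans h2)

/-- The canonical word depends only on the truth values of its rankers. Only the three-block ranker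
`r` is sensitive to the direction `d`. -/
theorem syntactic_mem_condPv_three (d : Dir) {r : Ranker ABC} (hrd : r ∈ rankers ABC d 3 3)
    (hr : ∀ s m t : List ABC, ABC.a ∉ s → ABC.a ∉ m → ABC.c ∉ m → ABC.c ∉ t →
      (Condensed (s ++ .c :: (m ++ .a :: t)) r ↔ ABC.b ∈ m)) :
    MonCat.of (syntacticCon exLang).Quotient ∈ condPv d 3 := by
  refine con_quotient_mem_of_le
    (subset_pvGenerated _ ⟨ABC, inferInstance, 3, le_rfl, rfl⟩) (Con.conGen_le.2 ?_)
  intro u v h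
  refine syntacticCon_of_exRun fun q => ?_
  rw [exRun_canonicalWord hr, exRun_canonicalWord hr v.toList]
  have e : ∀ {d' : Dir} {r : Ranker ABC}, (r.map Prod.fst).head? = some d' → r.length ≤ 2 →
      (Condensed u.toList r ↔ Condensed v.toList r) :=
    fun h0 h2 => h _ (mem_rankersLE_three h0 h2)
  have e0 : Condensed u.toList r ↔ Condensed v.toList r := h _ (Or.inl ⟨3, le_rfl, hrd⟩)
  unfold canonicalWord
  simp only [e (d' := .X) (r := [(.X, .a)]) rfl (by decide),
    e (d' := .X) (r := [(.X, .b)]) rfl (by decide),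
    e (d' := .X) (r := [(.X, .c)]) rfl (by decide),
    e (d' := .X) (r := [(.X, .a), (.X, .c)]) rfl (by decide),
    e (d' := .X) (r := [(.X, .a), (.Y, .b)]) rfl (by decide),
    e (d' := .Y) (r := [(.Y, .c), (.X, .b)]) rfl (by decide), e0]

theorem syntactic_mem_Rpv_three : MonCat.of (syntacticCon exLang).Quotient ∈ Rpv 3 :=
  syntactic_mem_condPv_three .X (r := [(.X, .a), (.Y, .c), (.X, .b)]) ⟨rfl, rfl, rfl⟩
    fun _ _ _ hs ham hcm _ => condensed_XYX_iff hs ham hcm (by decide)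

theorem syntactic_mem_Lpv_three : MonCat.of (syntacticCon exLang).Quotient ∈ Lpv 3 :=
  syntactic_mem_condPv_three .Y (r := [(.Y, .c), (.X, .a), (.Y, .b)]) ⟨rfl, rfl, rfl⟩
    fun _ _ _ _ ham hcm ht => condensed_YXY_iff ht ham hcm (by decide)

theorem exLang_mem_FOLang : exLang ∈ FOLang 2 ABC :=
  ⟨exSentence, exSentence_mem, exSentence_defines⟩

theorem syntactic_not_mem_pvJoin :
    MonCat.of (syntacticCon exLang).Quotient ∉ pvJoin (Rpv 2) (Lpv 2) :=
  fun h => not_recognizes_exLang h (recognizes_syntactic exLang)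

end Canonical

end FO2Words


theorem mainTheorem11 :
    -- the displayed sentence is in `FO²_2` and defines the language, which is `FO²_2`-definable
    (FO2Words.exSentence ∈ FO2Words.FOfrag FO2Words.ABC 2 ∧
      FO2Words.exSentence.Defines FO2Words.exLang ∧
      FO2Words.exLang ∈ FO2Words.FOLang 2 FO2Words.ABC) ∧
    -- no monoid in `R_2 ∨ L_2` recognizes the language
    (∀ M ∈ FO2Words.pvJoin (FO2Words.Rpv 2) (FO2Words.Lpv 2),
      ¬ FO2Words.Recognizes M FO2Words.exLang) ∧
    -- `R_2 ∨ L_2` is strictly contained in `FO²_2` and in `R_3 ∩ L_3`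
    FO2Words.pvJoin (FO2Words.Rpv 2) (FO2Words.Lpv 2) ⊂ FO2Words.FOpv 2 ∧
    FO2Words.pvJoin (FO2Words.Rpv 2) (FO2Words.Lpv 2) ⊂ FO2Words.Rpv 3 ∩ FO2Words.Lpv 3 ∧
    -- the class of `TL_2`-definable languages is properly contained in that of `FO²_2`
    FO2Words.ProperlyContained (FO2Words.TLLang 2) (FO2Words.FOLang 2) := by
  open FO2Words in
  refine ⟨⟨exSentence_mem, exSentence_defines, exLang_mem_FOLang⟩,
    fun M hM => not_recognizes_exLang hM, ?_, ?_, fun A _ => TLLang_subset_FOLang A,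
    ABC, inferInstance, exLang, exLang_mem_FOLang, exLang_not_mem_TLLang⟩
  -- Both strict inclusions are witnessed by the syntactic monoid of the example language: it
  -- recognizes the language and hence lies outside the join.
  · exact Set.ssubset_iff_exists.2 ⟨pvJoin_subset (condPv_two_subset _) (condPv_two_subset _),
      _, syntactic_mem_pvOf exLang_mem_FOLang, syntactic_not_mem_pvJoin⟩
  · exact Set.ssubset_iff_exists.2 ⟨Set.subset_inter
      (pvJoin_subset (condPv_succ_subset _ _ 2) (condPv_succ_subset _ _ 2))
      (pvJoin_subset (condPv_succ_subset _ _ 2) (condPv_succ_subset _ _ 2)),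
      _, ⟨syntactic_mem_Rpv_three, syntactic_mem_Lpv_three⟩, syntactic_not_mem_pvJoin⟩
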